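/- Let $X$ be a complex abelian surface. Write $\mathrm{NS}(X)\subseteq H^2(X,\mathbb Z)$ for its Néron–Severi lattice with the intersection pairing, $\rho(X)=\operatorname{rank}\mathrm{NS}(X)$ for its Picard number, $T(X)=\mathrm{NS}(X)^{\perp}\subseteq H^2(X,\mathbb Z)$ for its transcendental lattice, and $N(X)=H^0(X,\mathbb Z)\oplus \mathrm{NS}(X)\oplus H^4(X,\mathbb Z)$ for its numerical Grothendieck group, endowed with the Mukai pairing $(r,D,s)\cdot(r',D',s')=D\cdot D'-rs'-sr'$. A mirror partner of $X$ is a complex abelian surface $Y$ for which there exist lattice isometries $T(X)\cong N(Y)$ and $N(X)\cong T(Y)$. Let $U$ be the hyperbolic plane, the rank-$2$ lattice with Gram matrix $\begin{pmatrix}0&1\\1&0\end{pmatrix}$, and let $\mathbb Z(m)$ be the rank-one lattice generated by an element of square $m$. **Theorem.** The abelian surface $X$ admits a mirror partner if and only if - $\rho(X)\le 2$, or - $\rho(X)=3$ and there is an isometry $\mathrm{NS}(X)\cong\mathbb Z(-2n)\oplus U$ for some positive integer $n$. -/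

import Mathlib

/-!
# Abelian surfaces, their lattices, and mirror partners

A complex `2`-torus is `X = ℂ² / Γ` with `Γ ⊆ ℂ²` a lattice.  Then `H₁(X, ℤ) = Γ` and
`Hᵏ(X, ℤ)` is the group of alternating integral `k`-forms on `Γ`, with wedge product as cup product.
-/

noncomputable section

namespace MirrorAbelian

/-- A complex torus `ℂ² / Γ` of dimension `2`, given by the lattice `Γ` (a discrete subgroup
spanning `ℂ²` over `ℝ`). -/
structure ComplexTwoTorus where
  /-- The lattice `Γ = H₁(X, ℤ)`. -/
  Γ : Submodule ℤ (Fin 2 → ℂ)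
  discrete : DiscreteTopology Γ
  isZLattice : IsZLattice ℝ Γ

attribute [instance] ComplexTwoTorus.discrete ComplexTwoTorus.isZLattice

namespace ComplexTwoTorus

variable (X : ComplexTwoTorus)

/-- `H²(X, ℤ)`: alternating integral `2`-forms on `Γ`. -/
abbrev H2 : Type := X.Γ [⋀^Fin 2]→ₗ[ℤ] ℤ

/-- `H⁴(X, ℤ)`: alternating integral `4`-forms on `Γ`; the four arguments are indexed by
`Fin 2 ⊕ Fin 2`, in the order `inl 0, inl 1, inr 0, inr 1`. -/
abbrev H4 : Type := X.Γ [⋀^Fin 2 ⊕ Fin 2]→ₗ[ℤ] ℤ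

/-- The real coordinates `(Re z₀, Im z₀, Re z₁, Im z₁)` of `z ∈ ℂ²`. -/
def realCoord (z : Fin 2 → ℂ) : Fin 2 ⊕ Fin 2 → ℝ :=
  Sum.elim ![(z 0).re, (z 0).im] ![(z 1).re, (z 1).im]

/-- A `ℤ`-basis of `Γ` is admissible if it is positively oriented for the complex orientation of
`ℂ²`. -/
def IsAdmissible (b : Module.Basis (Fin 2 ⊕ Fin 2) ℤ X.Γ) : Prop :=
  0 < (Matrix.of fun i j => realCoord (b i : Fin 2 → ℂ) j).det

/-- The real coordinates as a linear equivalence. -/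
def realCoordEquiv : (Fin 2 → ℂ) ≃ₗ[ℝ] (Fin 2 ⊕ Fin 2 → ℝ) where
  toFun := realCoord
  invFun w := ![⟨w (.inl 0), w (.inl 1)⟩, ⟨w (.inr 0), w (.inr 1)⟩]
  map_add' z w := by
    ext i
    rcases i with i | i <;> fin_cases i <;> simp [realCoord]
  map_smul' c z := by
    ext i
    rcases i with i | i <;> fin_cases i <;> simp [realCoord]
  left_inv z := by
    ext i
    fin_cases i <;> simp [realCoord]
  right_inv w := by
    ext i
    rcases i with i | i <;> fin_cases i <;> simp [realCoord]

/-- The determinant in `IsAdmissible` changes by the determinant of the change of basis. -/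
theorem det_realCoord (b b' : Module.Basis (Fin 2 ⊕ Fin 2) ℤ X.Γ) :
    (Matrix.of fun i j => realCoord (b' i : Fin 2 → ℂ) j).det =
      (b.det b' : ℤ) * (Matrix.of fun i j => realCoord (b i : Fin 2 → ℂ) j).det := by
  have h : (Matrix.of fun i j => realCoord (b' i : Fin 2 → ℂ) j) =
      ((b.toMatrix b').map (Int.cast : ℤ → ℝ)).transpose *
        (Matrix.of fun i j => realCoord (b i : Fin 2 → ℂ) j) := by
    ext i j
    have h1 : (b' i : Fin 2 → ℂ) = ∑ k, ((b.toMatrix b' k i : ℤ) : ℝ) • (b k : Fin 2 → ℂ) := by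
      have h2 := congrArg (fun x : X.Γ => (x : Fin 2 → ℂ)) (b.sum_toMatrix_smul_self b' i)
      simp only [Submodule.coe_sum, Submodule.coe_smul] at h2
      rw [← h2]
      refine Finset.sum_congr rfl fun k _ => ?_
      rw [Int.cast_smul_eq_zsmul]
    have h3 := congrFun (congrArg realCoordEquiv h1) j
    rw [map_sum] at h3
    simp only [map_smul, Finset.sum_apply, Pi.smul_apply, smul_eq_mul] at h3
    simpa [Matrix.mul_apply, realCoordEquiv] using h3
  rw [h, Matrix.det_mul, Matrix.det_transpose, Module.Basis.det_apply, Int.cast_det]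

theorem det_realCoord_ne_zero (b : Module.Basis (Fin 2 ⊕ Fin 2) ℤ X.Γ) :
    (Matrix.of fun i j => realCoord (b i : Fin 2 → ℂ) j).det ≠ 0 := by
  have hli : LinearIndependent ℝ fun i => realCoordEquiv (b i : Fin 2 → ℂ) := by
    have := (b.ofZLatticeBasis ℝ X.Γ).linearIndependent.map'
      realCoordEquiv.toLinearMap realCoordEquiv.ker
    have h : (fun i => realCoordEquiv (b i : Fin 2 → ℂ)) =
        realCoordEquiv.toLinearMap ∘ b.ofZLatticeBasis ℝ X.Γ := by
      funext i
      simp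
    rw [h]
    exact this
  have hu := Matrix.linearIndependent_rows_iff_isUnit.mp
    (show LinearIndependent ℝ (Matrix.of fun i j => realCoord (b i : Fin 2 → ℂ) j).row from hli)
  exact ((Matrix.isUnit_iff_isUnit_det _).mp hu).ne_zero

theorem exists_isAdmissible : ∃ b, X.IsAdmissible b := by
  have hr : Module.finrank ℤ X.Γ = Fintype.card (Fin 2 ⊕ Fin 2) := by
    rw [ZLattice.rank ℝ X.Γ, realCoordEquiv.finrank_eq]
    simp
  let b : Module.Basis (Fin 2 ⊕ Fin 2) ℤ X.Γ :=
    (Module.finBasis ℤ X.Γ).reindex ((finCongr hr).trans (Fintype.equivFin _).symm)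
  rcases lt_or_gt_of_ne (X.det_realCoord_ne_zero b) with h | h
  · refine ⟨b.unitsSMul (Pi.mulSingle (.inl 0) (-1)), ?_⟩
    have hd : b.det (b.unitsSMul (Pi.mulSingle (.inl 0) (-1))) = -1 := by
      rw [Module.Basis.det_unitsSMul_self]
      simp [Fintype.prod_sum_type, Pi.mulSingle_apply]
    unfold IsAdmissible
    rw [X.det_realCoord b, hd]
    push_cast
    linarith
  · exact ⟨b, h⟩

/-- An admissible basis of `Γ`. -/
def admissibleBasis : Module.Basis (Fin 2 ⊕ Fin 2) ℤ X.Γ :=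
  X.exists_isAdmissible.choose

theorem isAdmissible_admissibleBasis : X.IsAdmissible X.admissibleBasis :=
  X.exists_isAdmissible.choose_spec

/-- The orientation isomorphism `H⁴(X, ℤ) → ℤ`: evaluation on an admissible basis. -/
def degree : X.H4 →ₗ[ℤ] ℤ where
  toFun ω := ω X.admissibleBasis
  map_add' _ _ := rfl
  map_smul' _ _ := rfl

/-- The degree does not depend on the admissible basis. -/
theorem degree_eq (ω : X.H4) {b : Module.Basis (Fin 2 ⊕ Fin 2) ℤ X.Γ} (hb : X.IsAdmissible b) :
    X.degree ω = ω b := by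
  set a := X.admissibleBasis with ha
  have ha' : X.IsAdmissible a := X.isAdmissible_admissibleBasis
  have h1 : (b.det a : ℤ) = 1 := by
    have h2 := X.det_realCoord b a
    unfold IsAdmissible at hb ha'
    have h3 : 0 < ((b.det a : ℤ) : ℝ) := by
      rw [h2] at ha'
      exact (pos_iff_pos_of_mul_pos ha').mpr hb
    have h4 : 0 < b.det a := by exact_mod_cast h3
    rcases Int.isUnit_iff.mp (b.isUnit_det a) with h | h
    · exact h
    · omega
  have h5 := congrArg (fun f => f a) (AlternatingMap.eq_smul_basis_det b ω)
  simp only [AlternatingMap.smul_apply, h1, smul_eq_mul, mul_one] at h5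
  exact h5

/-- The cup product `H²(X, ℤ) × H²(X, ℤ) → H⁴(X, ℤ)`, i.e. the wedge product. -/
def cup (E F : X.H2) : X.H4 :=
  (LinearMap.mul' ℤ ℤ).compAlternatingMap (E.domCoprod F)

theorem cup_eq (E F : X.H2) :
    X.cup E F = (LinearMap.mul' ℤ ℤ).compAlternatingMap
      (AlternatingMap.domCoprod' (TensorProduct.tmul ℤ E F)) := rfl

/-- The intersection pairing on `H²(X, ℤ)`. -/
def intersectionForm : LinearMap.BilinForm ℤ X.H2 :=
  LinearMap.mk₂ ℤ (fun E F => X.degree (X.cup E F))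
    (fun E E' F => by
      rw [cup_eq, TensorProduct.add_tmul, map_add, LinearMap.compAlternatingMap_add, map_add]; rfl)
    (fun c E F => by
      rw [cup_eq, ← TensorProduct.smul_tmul', map_smul, LinearMap.compAlternatingMap_smul,
        map_smul]; rfl)
    (fun E F F' => by
      rw [cup_eq, TensorProduct.tmul_add, map_add, LinearMap.compAlternatingMap_add, map_add]; rfl)
    (fun c E F => by
      rw [cup_eq, TensorProduct.tmul_smul, map_smul, LinearMap.compAlternatingMap_smul,
        map_smul]; rfl)

/-- `A` is the `ℝ`-linear extension to `ℂ² = Γ ⊗ ℝ` of the integral form `E`; it is uniquely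
determined by `E`. -/
def IsRealExtension (E : X.H2) (A : (Fin 2 → ℂ) [⋀^Fin 2]→ₗ[ℝ] ℝ) : Prop :=
  ∀ x y : X.Γ, A ![(x : Fin 2 → ℂ), (y : Fin 2 → ℂ)] = (E ![x, y] : ℝ)

/-- A real alternating `2`-form on `ℂ²` is of type `(1,1)` if it is invariant under
multiplication by `i`; equivalently, it is the imaginary part of a Hermitian form. -/
def IsType11 (A : (Fin 2 → ℂ) [⋀^Fin 2]→ₗ[ℝ] ℝ) : Prop :=
  ∀ v w : Fin 2 → ℂ, A ![Complex.I • v, Complex.I • w] = A ![v, w]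

/-- The Néron–Severi group `NS(X) = H²(X, ℤ) ∩ H^{1,1}(X)`. -/
def NS : Submodule ℤ X.H2 where
  carrier := {E | ∃ A, X.IsRealExtension E A ∧ IsType11 A}
  zero_mem' := ⟨0, fun _ _ => by simp, fun _ _ => rfl⟩
  add_mem' := by
    rintro E F ⟨A, hA, hA'⟩ ⟨B, hB, hB'⟩
    refine ⟨A + B, fun x y => ?_, fun v w => ?_⟩
    · simp [hA x y, hB x y]
    · simp [hA' v w, hB' v w]
  smul_mem' := by
    rintro c E ⟨A, hA, hA'⟩
    refine ⟨(c : ℝ) • A, fun x y => ?_, fun v w => ?_⟩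
    · simp [hA x y]
    · simp [hA' v w]

/-- A polarization (Riemann form): an integral form of type `(1,1)` whose associated Hermitian form
`H(v, w) = A(iv, w) + i A(v, w)` is positive definite. -/
def IsPolarization (E : X.H2) : Prop :=
  ∃ A, X.IsRealExtension E A ∧ IsType11 A ∧ ∀ v : Fin 2 → ℂ, v ≠ 0 → 0 < A ![Complex.I • v, v]

end ComplexTwoTorus

/-- A complex abelian surface: a complex `2`-torus that admits a polarization. -/
structure AbelianSurface extends ComplexTwoTorus where
  exists_polarization : ∃ E, toComplexTwoTorus.IsPolarization E

namespace AbelianSurface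

variable (X : AbelianSurface)

/-- The Picard number `ρ(X)`, the rank of `NS(X)`. -/
def picardNumber : ℕ := Module.finrank ℤ X.NS

/-- The Néron–Severi lattice: the intersection pairing on `NS(X)`. -/
def formNS : LinearMap.BilinForm ℤ X.NS := X.intersectionForm.restrict X.NS

/-- The transcendental lattice `T(X) = NS(X)^⊥ ⊆ H²(X, ℤ)`. -/
def T : Submodule ℤ X.H2 := X.intersectionForm.orthogonal X.NS

/-- The intersection pairing on `T(X)`. -/
def formT : LinearMap.BilinForm ℤ X.T := X.intersectionForm.restrict X.T

/-- The even cohomology `H⁰ ⊕ H² ⊕ H⁴`, with `H⁰(X, ℤ) = ℤ` and `H⁴(X, ℤ) = ℤ`. -/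
abbrev Hev : Type := ℤ × X.H2 × ℤ

/-- The Mukai pairing `(r, D, s) · (r', D', s') = D D' - r s' - s r'`. -/
def mukaiForm : LinearMap.BilinForm ℤ X.Hev :=
  LinearMap.mk₂ ℤ
    (fun x y => X.intersectionForm x.2.1 y.2.1 - x.1 * y.2.2 - x.2.2 * y.1)
    (fun x x' y => by
      simp only [Prod.fst_add, Prod.snd_add, map_add, LinearMap.add_apply]; ring)
    (fun c x y => by
      simp only [Prod.smul_fst, Prod.smul_snd, map_smul, LinearMap.smul_apply, smul_eq_mul]; ring)
    (fun x y y' => by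
      simp only [Prod.fst_add, Prod.snd_add, map_add]; ring)
    (fun c x y => by
      simp only [Prod.smul_fst, Prod.smul_snd, map_smul, smul_eq_mul]; ring)

/-- The numerical Grothendieck group `N(X) = H⁰ ⊕ NS(X) ⊕ H⁴`. -/
def N : Submodule ℤ X.Hev := (⊤ : Submodule ℤ ℤ).prod (X.NS.prod (⊤ : Submodule ℤ ℤ))

/-- The Mukai pairing on `N(X)`. -/
def formN : LinearMap.BilinForm ℤ X.N := X.mukaiForm.restrict X.N

/-- `X` and `Y` are mirror partners if there are isometries `T(X) ≅ N(Y)` and `N(X) ≅ T(Y)`. -/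
def MirrorPartners (X Y : AbelianSurface) : Prop :=
  X.formT.Equivalent Y.formN ∧ X.formN.Equivalent Y.formT

end AbelianSurface

/-- The rank-one lattice `ℤ(m)`, generated by an element of square `m`. -/
def rankOneForm (m : ℤ) : LinearMap.BilinForm ℤ ℤ := m • LinearMap.mul ℤ ℤ

/-- The hyperbolic plane `U`, with Gram matrix `(0 1; 1 0)`. -/
def hyperbolicPlane : LinearMap.BilinForm ℤ (Fin 2 → ℤ) := Matrix.toBilin' !![0, 1; 1, 0]

/-- The orthogonal direct sum of two bilinear forms. -/
def orthogonalSum {M N : Type*} [AddCommGroup M] [AddCommGroup N]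
    (B : LinearMap.BilinForm ℤ M) (C : LinearMap.BilinForm ℤ N) :
    LinearMap.BilinForm ℤ (M × N) :=
  B.compl₁₂ (LinearMap.fst ℤ M N) (LinearMap.fst ℤ M N) +
    C.compl₁₂ (LinearMap.snd ℤ M N) (LinearMap.snd ℤ M N)

end MirrorAbelian

end

/-! With its intersection form, H²(X, ℤ) is U ⊕ U ⊕ U, and N(Y) is NS(Y) plus a hyperbolic plane. So
an isometry T(X) ≅ N(Y) puts into T(X) a hyperbolic pair e, f and, orthogonal to it, a vector m
coming from a class of positive square in NS(Y): an `IsMirrorTriple`.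

Conversely, a triple suffices. Surjectivity of the period map gives a torus, with H² identified
isometrically with H²(X, ℤ), whose Néron–Severi lattice is the complement of e, f in T(X)
(`exists_torus_of_hyperbolicPair`). A (1,1)-class of positive square is definite, so m or -m
polarizes this torus. Since H² is unimodular and NS(X) is nondegenerate and saturated, its
transcendental lattice is ⟨e, f⟩ ⊕ NS(X) ≅ N(X) (`IsMirrorTriple.exists_mirrorPartners`).

It remains to decide when T(X) contains a triple. Transvections of U³ carry e, f to the first plane
of a frame (`exists_first_pair`) and then m to α(l E₁ + F₁) with l > 0 (`exists_reduced`). Thus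
NS(X) lies in the complement of E₀, F₀, m, spanned by F₁ - l E₁, E₂, F₂ and isometric to ℤ(-2l) ⊕ U.
Its rank is therefore at most 3, and in rank 3 saturation forces equality. In the other direction
the same normal forms, applied to generators of NS(X) up to multiples, exhibit a triple. -/

namespace MirrorAbelian

/-! ### Frames of U ⊕ U ⊕ U and the action of transvections -/

section Frames

variable {L : Type*} [AddCommGroup L]

/-- `(e i, f i)` for `i = 0, 1, 2` are three mutually orthogonal hyperbolic pairs that span `L`:
they identify `L` with `U ⊕ U ⊕ U`. -/
structure IsFrame (B : LinearMap.BilinForm ℤ L) (e f : Fin 3 → L) : Prop where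
  symm : ∀ x y, B x y = B y x
  ee : ∀ i j, B (e i) (e j) = 0
  ff : ∀ i j, B (f i) (f j) = 0
  ef : ∀ i j, B (e i) (f j) = if i = j then 1 else 0
  expand : ∀ x, x = ∑ i, (B x (f i) • e i + B x (e i) • f i)

namespace IsFrame

variable {B : LinearMap.BilinForm ℤ L} {e f : Fin 3 → L}

theorem fe (h : IsFrame B e f) (i j : Fin 3) : B (f i) (e j) = if i = j then 1 else 0 := by
  rw [h.symm, h.ef]
  simp only [eq_comm]

theorem expand' (h : IsFrame B e f) (x : L) :
    x = (B x (f 0) • e 0 + B x (e 0) • f 0) + (B x (f 1) • e 1 + B x (e 1) • f 1) +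
      (B x (f 2) • e 2 + B x (e 2) • f 2) := by
  conv_lhs => rw [h.expand x, Fin.sum_univ_three]

theorem apply_eq (h : IsFrame B e f) (x y : L) :
    B x y = (B x (f 0) * B y (e 0) + B x (e 0) * B y (f 0)) +
      (B x (f 1) * B y (e 1) + B x (e 1) * B y (f 1)) +
      (B x (f 2) * B y (e 2) + B x (e 2) * B y (f 2)) := by
  conv_lhs => rw [h.expand' x]
  simp only [map_add, map_smul, LinearMap.add_apply, LinearMap.smul_apply, smul_eq_mul,
    h.symm y]

theorem comp_perm (h : IsFrame B e f) (σ : Equiv.Perm (Fin 3)) : IsFrame B (e ∘ σ) (f ∘ σ) where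
  symm := h.symm
  ee i j := h.ee _ _
  ff i j := h.ff _ _
  ef i j := by simp [h.ef]
  expand x := by
    conv_lhs => rw [h.expand x]
    exact (Equiv.sum_comp σ fun i => B x (f i) • e i + B x (e i) • f i).symm

/-- Exchanging `e i` and `f i`. -/
theorem flip (h : IsFrame B e f) (i : Fin 3) :
    IsFrame B (Function.update e i (f i)) (Function.update f i (e i)) where
  symm := h.symm
  ee j k := by
    by_cases hj : j = i <;> by_cases hk : k = i <;>
      simp [hj, hk, h.ee, h.ff, h.ef, h.fe]
    exact fun h => hk h.symm
  ff j k := by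
    by_cases hj : j = i <;> by_cases hk : k = i <;>
      simp [hj, hk, h.ee, h.ff, h.ef, h.fe]
    exact fun h => hk h.symm
  ef j k := by
    by_cases hj : j = i <;> by_cases hk : k = i <;>
      simp [hj, hk, h.ee, h.ff, h.ef, h.fe]
    exact fun h => hk h.symm
  expand x := by
    conv_lhs => rw [h.expand x]
    refine Finset.sum_congr rfl fun j _ => ?_
    by_cases hj : j = i
    · subst hj
      simp [add_comm]
    · simp [hj]

/-- The elementary transvection `e i ↦ e i + t e j`, `f j ↦ f j - t f i`. -/
theorem transvection (h : IsFrame B e f) {i j : Fin 3} (hij : i ≠ j) (t : ℤ) :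
    IsFrame B (fun k => e k + (if k = i then t else 0) • e j)
      (fun k => f k - (if k = j then t else 0) • f i) where
  symm := h.symm
  ee k l := by simp only [map_add, map_smul, LinearMap.add_apply, LinearMap.smul_apply, h.ee,
    smul_zero, add_zero]
  ff k l := by simp only [map_sub, map_smul, LinearMap.sub_apply, LinearMap.smul_apply, h.ff,
    smul_zero, sub_zero]
  ef k l := by
    simp only [map_add, map_sub, map_smul, LinearMap.add_apply, LinearMap.smul_apply, h.ef,
      smul_eq_mul, if_neg hij.symm]
    by_cases hk : k = i <;> by_cases hl : l = j <;> simp [hk, hl, hij]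
    intro h; exact absurd h.symm hl
  expand x := by
    have key : ∀ k, (B x (f k - (if k = j then t else 0) • f i)) •
          (e k + (if k = i then t else 0) • e j) +
        (B x (e k + (if k = i then t else 0) • e j)) • (f k - (if k = j then t else 0) • f i) =
        (B x (f k) • e k + B x (e k) • f k) +
          ((if k = i then (t * B x (f k)) • e j + (t * B x (e j)) • f k else 0) -
          (if k = j then (t * B x (f i)) • e k + (t * B x (e k)) • f i else 0)) := by
      intro k
      by_cases hk : k = i
      · subst hk
        simp only [if_neg hij, if_true, map_add, map_sub, map_smul, smul_eq_mul]
        module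
      · by_cases hk' : k = j
        · simp only [if_neg hk, if_pos hk', map_add, map_sub, map_smul, smul_eq_mul]
          module
        · simp only [if_neg hk, if_neg hk', map_add, map_sub, map_smul, smul_eq_mul]
          module
    rw [Finset.sum_congr rfl fun k _ => key k, Finset.sum_add_distrib, Finset.sum_sub_distrib,
      ← h.expand x]
    simp

/-- Euclidean algorithm in the last two planes, the first pair being kept fixed. Transvections and
flips act on the four coefficients of `v` there; a frame minimizing the nonzero value |B v (e' 1)|
makes that value divide the others, so the third plane can be cleared. -/
theorem exists_reduced (h : IsFrame B e f) (v : L) :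
    ∃ e' f' : Fin 3 → L, IsFrame B e' f' ∧ e' 0 = e 0 ∧ f' 0 = f 0 ∧
      B v (e' 2) = 0 ∧ B v (f' 2) = 0 ∧ B v (e' 1) ∣ B v (f' 1) := by
  classical
  let P : ℕ → Prop := fun n => n ≠ 0 ∧ ∃ e' f' : Fin 3 → L, IsFrame B e' f' ∧ e' 0 = e 0 ∧
    f' 0 = f 0 ∧ (B v (e' 1)).natAbs = n
  have hswap : ∀ {e' f' : Fin 3 → L}, IsFrame B e' f' →
      IsFrame B (e' ∘ Equiv.swap 1 2) (f' ∘ Equiv.swap 1 2) := fun h' => h'.comp_perm _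
  by_cases hP : ∃ n, P n
  · obtain ⟨hn0, e₁, f₁, h₁, he₁, hf₁, hn⟩ := Nat.find_spec hP
    set n := Nat.find hP with hn_def
    have hmin : ∀ {e' f' : Fin 3 → L}, IsFrame B e' f' → e' 0 = e 0 → f' 0 = f 0 →
        (B v (e' 1)).natAbs < n → B v (e' 1) = 0 := by
      intro e' f' h' he hf hlt
      by_contra hne
      exact Nat.find_min hP hlt ⟨by simpa using hne, e', f', h', he, hf, rfl⟩
    -- A transvection replaces the coefficient at `e' 2` by its remainder modulo the one at `e' 1`;
    -- swapping the two planes moves it to position 1, where minimality forces it to vanish.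
    have hdvd : ∀ {e' f' : Fin 3 → L}, IsFrame B e' f' → e' 0 = e 0 → f' 0 = f 0 →
        (B v (e' 1)).natAbs = n → B v (e' 1) ∣ B v (e' 2) := by
      intro e' f' h' he hf hn'
      have ht := hswap (h'.transvection (i := 2) (j := 1) (by decide)
        (-(B v (e' 2) / B v (e' 1))))
      have h0 : B v (e' 1) ≠ 0 := by
        intro h; rw [h] at hn'; exact hn0 (by simpa using hn'.symm)
      have hval : B v (e' 2 + (-(B v (e' 2) / B v (e' 1))) • e' 1) =
          B v (e' 2) % B v (e' 1) := by
        rw [map_add, map_smul, smul_eq_mul, Int.emod_def]; ring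
      have := hmin ht (by simp [he, show Equiv.swap (1 : Fin 3) 2 0 = 0 by decide])
        (by simp [hf, show Equiv.swap (1 : Fin 3) 2 0 = 0 by decide]) (by
          simp only [Function.comp_apply, Equiv.swap_apply_left, if_true]
          rw [hval, ← hn']
          have h1 := Int.emod_nonneg (B v (e' 2)) h0
          have h2 := Int.emod_lt_abs (B v (e' 2)) h0
          zify
          rwa [abs_of_nonneg h1])
      simp only [Function.comp_apply, Equiv.swap_apply_left, if_true] at this
      rw [hval] at this
      exact Int.dvd_of_emod_eq_zero this
    have hclear : ∀ {e' f' : Fin 3 → L}, IsFrame B e' f' → e' 0 = e 0 → f' 0 = f 0 →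
        (B v (e' 1)).natAbs = n → ∃ e'' f'' : Fin 3 → L, IsFrame B e'' f'' ∧ e'' 0 = e 0 ∧
          f'' 0 = f 0 ∧ e'' 1 = e' 1 ∧ f'' 2 = f' 2 ∧ B v (e'' 2) = 0 := by
      intro e' f' h' he hf hn'
      obtain ⟨q, hq⟩ := hdvd h' he hf hn'
      refine ⟨_, _, h'.transvection (i := 2) (j := 1) (by decide) (-q), ?_, ?_, ?_, ?_, ?_⟩
      · simp [he]
      · simp [hf]
      · simp
      · simp
      · simp [hq]; ring
    obtain ⟨e₂, f₂, h₂, he₂, hf₂, h21, -, h22⟩ := hclear h₁ he₁ hf₁ hn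
    obtain ⟨e₃, f₃, h₃, he₃, hf₃, h31, h32, h33⟩ := hclear (h₂.flip 2) (by simpa using he₂)
      (by simpa using hf₂) (by simpa [h21] using hn)
    have hn₃ : (B v (e₃ 1)).natAbs = n := by simpa [h31, h21] using hn
    refine ⟨e₃, f₃, h₃, he₃, hf₃, h33, by simpa [h32] using h22, ?_⟩
    have h34 : B v (f₃ 2) = 0 := by simpa [h32] using h22
    -- This frame has `e 1 = e₃ 1 - f₃ 2` and `e 2 = e₃ 2 + f₃ 1`, which brings the coefficient at
    -- `f₃ 1` within reach of `hdvd`.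
    have h₄ := ((h₃.flip 1).transvection (i := 2) (j := 1) (by decide) 1).flip 1
    have := hdvd h₄ (by simp [he₃]) (by simp [hf₃]) (by simp [h34, hn₃])
    simpa [h34, h33] using this
  -- Here no admissible frame has a nonzero coefficient, so permuting and flipping shows that all
  -- four vanish.
  · have hz : ∀ {e' f' : Fin 3 → L}, IsFrame B e' f' → e' 0 = e 0 → f' 0 = f 0 →
        B v (e' 1) = 0 := by
      intro e' f' h' he hf
      by_contra hne
      exact hP ⟨_, by simpa using hne, e', f', h', he, hf, rfl⟩
    refine ⟨e, f, h, rfl, rfl, ?_, ?_, ?_⟩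
    · simpa using hz (hswap h) (by simp [show Equiv.swap (1 : Fin 3) 2 0 = 0 by decide])
        (by simp [show Equiv.swap (1 : Fin 3) 2 0 = 0 by decide])
    · simpa using hz (hswap (h.flip 2))
        (by simp [show Equiv.swap (1 : Fin 3) 2 0 = 0 by decide])
        (by simp [show Equiv.swap (1 : Fin 3) 2 0 = 0 by decide])
    · rw [show B v (f 1) = 0 by simpa using hz (h.flip 1) (by simp) (by simp)]
      exact dvd_zero _

/-- Every vector lies in a hyperbolic plane of some frame. -/
theorem exists_mem_first (h : IsFrame B e f) (v : L) :
    ∃ (e' f' : Fin 3 → L) (d k : ℤ), IsFrame B e' f' ∧ v = d • (k • e' 0 + f' 0) := by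
  obtain ⟨e₁, f₁, h₁, -, -, h11, h12, -⟩ := h.exists_reduced v
  -- The cleared plane is moved to the first position, which a second reduction leaves alone; `v`
  -- then survives only in one plane.
  obtain ⟨e₂, f₂, h₂, he₂, hf₂, h21, h22, k, hk⟩ :=
    (h₁.comp_perm (Equiv.swap 0 2)).exists_reduced v
  have he₂' : B v (e₂ 0) = 0 := by rw [he₂]; simpa using h11
  have hf₂' : B v (f₂ 0) = 0 := by rw [hf₂]; simpa using h12
  refine ⟨_, _, B v (e₂ 1), k, h₂.comp_perm (Equiv.swap 0 1), ?_⟩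
  conv_lhs => rw [h₂.expand' v, h21, h22, he₂', hf₂', hk]
  simp only [Function.comp_apply, Equiv.swap_apply_left]
  module

/-- Every isotropic vector that pairs to `1` with some vector is the first vector of a frame. -/
theorem exists_first_eq (h : IsFrame B e f) {u w : L} (hu : B u u = 0) (huw : B u w = 1) :
    ∃ e' f' : Fin 3 → L, IsFrame B e' f' ∧ e' 0 = u := by
  obtain ⟨e₁, f₁, d, k, h₁, rfl⟩ := h.exists_mem_first u
  -- Pairing to 1 makes the vector primitive, so d = ±1; its square 2kd² vanishes, so k = 0. The
  -- vector is thus ±`f₁ 0`, and a flip followed by multiplying the whole frame by the sign d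
  -- finishes.
  have hd : IsUnit d := by
    refine IsUnit.of_mul_eq_one (B (k • e₁ 0 + f₁ 0) w) ?_
    rw [← huw, map_smul, LinearMap.smul_apply, smul_eq_mul]
  have hd2 : d * d = 1 := by rcases Int.isUnit_iff.mp hd with rfl | rfl <;> rfl
  have hk : k = 0 := by
    simp only [map_add, map_smul, LinearMap.add_apply, LinearMap.smul_apply, smul_eq_mul,
      h₁.ee, h₁.ff, h₁.ef, h₁.fe, if_true] at hu
    have : 2 * k * (d * d) = 0 := by linarith
    rw [hd2] at this
    omega
  subst hk
  have h₂ := h₁.flip 0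
  refine ⟨fun i => d • Function.update e₁ 0 (f₁ 0) i, fun i => d • Function.update f₁ 0 (e₁ 0) i,
    ⟨h.symm, fun i j => ?_, fun i j => ?_, fun i j => ?_, fun x => ?_⟩, by simp⟩
  · simp only [map_smul, LinearMap.smul_apply, h₂.ee, smul_zero]
  · simp only [map_smul, LinearMap.smul_apply, h₂.ff, smul_zero]
  · simp only [map_smul, LinearMap.smul_apply, h₂.ef, smul_smul, hd2, one_smul]
  · conv_lhs => rw [h₂.expand x]
    refine Finset.sum_congr rfl fun i _ => ?_
    simp only [map_smul, smul_eq_mul, smul_smul, mul_right_comm d, hd2, one_mul]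

/-- Replacing `e j` by `e j - t e 0`, so that it becomes orthogonal to a given vector. -/
theorem exists_clear (h : IsFrame B e f) {w : L} (hw : B w (e 0) = 1) {j : Fin 3} (hj : j ≠ 0) :
    ∃ e' f' : Fin 3 → L, IsFrame B e' f' ∧ e' 0 = e 0 ∧ B w (e' j) = 0 ∧
      (∀ k, k ≠ j → e' k = e k) ∧ (∀ k, k ≠ 0 → f' k = f k) := by
  refine ⟨_, _, h.transvection (i := j) (j := 0) hj (-B w (e j)), ?_, ?_, ?_, ?_⟩
  · simp [hj.symm]
  · simp [hw]
  · intro k hk; simp [hk]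
  · intro k hk; simp [hk]

/-- Every hyperbolic pair is the first pair of a frame. -/
theorem exists_first_pair (h : IsFrame B e f) {u w : L} (hu : B u u = 0) (hw : B w w = 0)
    (huw : B u w = 1) : ∃ e' f' : Fin 3 → L, IsFrame B e' f' ∧ e' 0 = u ∧ f' 0 = w := by
  obtain ⟨e₁, f₁, h₁, he₁⟩ := h.exists_first_eq hu huw
  -- Clear `e j`, flip the plane, clear what was `f j`, and flip back. Once both planes are cleared,
  -- w = c e₀ + f₀, and w² = 2c = 0 gives w = f₀.
  have step : ∀ {e' f' : Fin 3 → L}, IsFrame B e' f' → e' 0 = u → ∀ j : Fin 3, j ≠ 0 →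
      ∃ e'' f'' : Fin 3 → L, IsFrame B e'' f'' ∧ e'' 0 = u ∧ B w (e'' j) = 0 ∧
        B w (f'' j) = 0 ∧ ∀ k, k ≠ 0 → k ≠ j → e'' k = e' k ∧ f'' k = f' k := by
    intro e' f' h' he j hj
    obtain ⟨e₂, f₂, h₂, he₂, h21, h22, h23⟩ :=
      h'.exists_clear (w := w) (by rw [he, h.symm, huw]) hj
    obtain ⟨e₃, f₃, h₃, he₃, h31, h32, h33⟩ :=
      (h₂.flip j).exists_clear (w := w) (by simp [hj.symm, he₂, he, h.symm w, huw]) hj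
    refine ⟨_, _, h₃.flip j, ?_, ?_, ?_, fun k hk hkj => ⟨?_, ?_⟩⟩
    · simp [hj.symm, he₃, he₂, he]
    · simp [h33 j hj, h21]
    · simpa using h31
    · simp [hkj, h32 k hkj, h22 k hkj]
    · simp [hkj, h33 k hk, h23 k hk]
  obtain ⟨e₂, f₂, h₂, he₂, h21, h22, -⟩ := step h₁ he₁ 1 (by decide)
  obtain ⟨e₃, f₃, h₃, he₃, h31, h32, h33⟩ := step h₂ he₂ 2 (by decide)
  obtain ⟨h34, h35⟩ := h33 1 (by decide) (by decide)
  refine ⟨e₃, f₃, h₃, he₃, ?_⟩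
  have hw0 : B w (e₃ 0) = 1 := by rw [he₃, h.symm, huw]
  have hw1 : w = B w (f₃ 0) • e₃ 0 + f₃ 0 := by
    conv_lhs => rw [h₃.expand' w, h31, h32, h34, h35, h21, h22, hw0]
    module
  have hw2 : B w (f₃ 0) = 0 := by
    have := h₃.apply_eq w w
    rw [h31, h32, h34, h35, h21, h22, hw0, hw] at this
    omega
  rw [hw2] at hw1
  rw [hw1]
  module

end IsFrame

end Frames

end MirrorAbelian

noncomputable section

namespace MirrorAbelian

/-! ### The wedge product in coordinates -/

section Wedge

theorem sum_perm_fin_succ {A : Type*} [AddCommMonoid A] {n : ℕ}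
    (F : Equiv.Perm (Fin (n + 1)) → A) :
    ∑ σ, F σ = ∑ p : Fin (n + 1), ∑ τ : Equiv.Perm (Fin n),
      F (Equiv.Perm.decomposeFin.symm (p, τ)) := by
  rw [← Equiv.sum_comp Equiv.Perm.decomposeFin.symm, Fintype.sum_prod_type]

/-- The two antisymmetries make the summand constant on the cosets of S₂ × S₂, which have four
elements each; one term is left for each of the six shuffles. -/
theorem sum_sign_perm_fin_four {A : Type*} [AddCommGroup A]
    (g : Fin 4 → Fin 4 → Fin 4 → Fin 4 → A) (h₁ : ∀ i j k l, g i j k l = -g j i k l)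
    (h₂ : ∀ i j k l, g i j k l = -g i j l k) :
    ∑ σ : Equiv.Perm (Fin 4), (Equiv.Perm.sign σ : ℤ) • g (σ 0) (σ 1) (σ 2) (σ 3) =
      4 • (g 0 1 2 3 - g 0 2 1 3 + g 0 3 1 2 + g 1 2 0 3 - g 1 3 0 2 + g 2 3 0 1) := by
  have p4 : ∀ F : Equiv.Perm (Fin 4) → A, ∑ σ, F σ = ∑ p : Fin 4, ∑ τ : Equiv.Perm (Fin 3),
    F (Equiv.Perm.decomposeFin.symm (p, τ)) := sum_perm_fin_succ
  have p3 : ∀ F : Equiv.Perm (Fin 3) → A, ∑ σ, F σ = ∑ p : Fin 3, ∑ τ : Equiv.Perm (Fin 2),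
    F (Equiv.Perm.decomposeFin.symm (p, τ)) := sum_perm_fin_succ
  have p2 : ∀ F : Equiv.Perm (Fin 2) → A, ∑ σ, F σ = ∑ p : Fin 2, ∑ τ : Equiv.Perm (Fin 1),
    F (Equiv.Perm.decomposeFin.symm (p, τ)) := sum_perm_fin_succ
  have a0 : ∀ (p : Fin 4) (τ : Equiv.Perm (Fin 3)),
    Equiv.Perm.decomposeFin.symm (p, τ) 0 = p := fun p τ =>
      Equiv.Perm.decomposeFin_symm_apply_zero p τ
  have a1 : ∀ (p : Fin 4) (τ : Equiv.Perm (Fin 3)),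
    Equiv.Perm.decomposeFin.symm (p, τ) 1 = Equiv.swap 0 p (τ 0).succ := fun p τ =>
      Equiv.Perm.decomposeFin_symm_apply_succ τ p 0
  have a2 : ∀ (p : Fin 4) (τ : Equiv.Perm (Fin 3)),
    Equiv.Perm.decomposeFin.symm (p, τ) 2 = Equiv.swap 0 p (τ 1).succ := fun p τ =>
      Equiv.Perm.decomposeFin_symm_apply_succ τ p 1
  have a3 : ∀ (p : Fin 4) (τ : Equiv.Perm (Fin 3)),
    Equiv.Perm.decomposeFin.symm (p, τ) 3 = Equiv.swap 0 p (τ 2).succ := fun p τ =>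
      Equiv.Perm.decomposeFin_symm_apply_succ τ p 2
  have s3 : ∀ (p : Fin 4) (τ : Equiv.Perm (Fin 3)),
    Equiv.Perm.sign (Equiv.Perm.decomposeFin.symm (p, τ)) =
      ite (p = 0) 1 (-1) * Equiv.Perm.sign τ := Equiv.Perm.decomposeFin.symm_sign
  have b0 : ∀ (p : Fin 3) (τ : Equiv.Perm (Fin 2)),
    Equiv.Perm.decomposeFin.symm (p, τ) 0 = p := fun p τ =>
      Equiv.Perm.decomposeFin_symm_apply_zero p τ
  have b1 : ∀ (p : Fin 3) (τ : Equiv.Perm (Fin 2)),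
    Equiv.Perm.decomposeFin.symm (p, τ) 1 = Equiv.swap 0 p (τ 0).succ := fun p τ =>
      Equiv.Perm.decomposeFin_symm_apply_succ τ p 0
  have b2 : ∀ (p : Fin 3) (τ : Equiv.Perm (Fin 2)),
    Equiv.Perm.decomposeFin.symm (p, τ) 2 = Equiv.swap 0 p (τ 1).succ := fun p τ =>
      Equiv.Perm.decomposeFin_symm_apply_succ τ p 1
  have s2 : ∀ (p : Fin 3) (τ : Equiv.Perm (Fin 2)),
    Equiv.Perm.sign (Equiv.Perm.decomposeFin.symm (p, τ)) =
      ite (p = 0) 1 (-1) * Equiv.Perm.sign τ := Equiv.Perm.decomposeFin.symm_sign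
  have c0 : ∀ (p : Fin 2) (τ : Equiv.Perm (Fin 1)),
    Equiv.Perm.decomposeFin.symm (p, τ) 0 = p := fun p τ =>
      Equiv.Perm.decomposeFin_symm_apply_zero p τ
  have c1 : ∀ (p : Fin 2) (τ : Equiv.Perm (Fin 1)),
    Equiv.Perm.decomposeFin.symm (p, τ) 1 = Equiv.swap 0 p (τ 0).succ := fun p τ =>
      Equiv.Perm.decomposeFin_symm_apply_succ τ p 0
  have s1 : ∀ (p : Fin 2) (τ : Equiv.Perm (Fin 1)),
    Equiv.Perm.sign (Equiv.Perm.decomposeFin.symm (p, τ)) =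
      ite (p = 0) 1 (-1) * Equiv.Perm.sign τ := Equiv.Perm.decomposeFin.symm_sign
  have t : ∀ τ : Equiv.Perm (Fin 1), τ 0 = 0 := fun τ => Subsingleton.elim _ _
  simp only [p4, p3, p2, a0, a1, a2, a3, b0, b1, b2, c0, c1, s1, s2, s3]
  simp only [Fin.sum_univ_four, Fin.sum_univ_three, Fin.sum_univ_two, Fintype.sum_unique, t,
    Equiv.swap_apply_def, Equiv.Perm.sign_one, Fin.reduceEq, Fin.reduceSucc, if_true, if_false,
    Equiv.Perm.default_eq, one_mul, mul_one, neg_mul, neg_neg, Units.val_neg, Units.val_one,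
    neg_smul, one_smul, h₁ 1 0, h₁ 2 0, h₁ 3 0, h₁ 2 1, h₁ 3 1, h₁ 3 2,
    h₂ _ _ 1 0, h₂ _ _ 2 0, h₂ _ _ 3 0, h₂ _ _ 2 1, h₂ _ _ 3 1, h₂ _ _ 3 2]
  abel

/-- The wedge product of two alternating forms in coordinates. -/
def wedgePair {R : Type*} [CommRing R] (p q : Fin 2 ⊕ Fin 2 → Fin 2 ⊕ Fin 2 → R) : R :=
  p (.inl 0) (.inl 1) * q (.inr 0) (.inr 1) - p (.inl 0) (.inr 0) * q (.inl 1) (.inr 1) +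
    p (.inl 0) (.inr 1) * q (.inl 1) (.inr 0) + p (.inl 1) (.inr 0) * q (.inl 0) (.inr 1) -
    p (.inl 1) (.inr 1) * q (.inl 0) (.inr 0) + p (.inr 0) (.inr 1) * q (.inl 0) (.inl 1)

theorem alternating_swap {R M : Type*} [CommRing R] [AddCommGroup M] [Module R M]
    (E : M [⋀^Fin 2]→ₗ[R] R) (x y : M) : E ![x, y] = -E ![y, x] := by
  have := E.map_swap ![y, x] (i := 0) (j := 1) (by decide)
  rw [← this]
  congr 1
  funext i
  fin_cases i <;> rfl

/-- The factor 4 = 2!·2! is the one relating the full alternatization of the tensor product to the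
shuffle product; over a domain of characteristic zero it cancels. -/
theorem four_smul_domCoprod {R M : Type*} [CommRing R] [AddCommGroup M] [Module R M]
    (E F : M [⋀^Fin 2]→ₗ[R] R) (v : Fin 2 ⊕ Fin 2 → M) :
    (4 : ℕ) • (LinearMap.mul' R R).compAlternatingMap (E.domCoprod F) v =
      (4 : ℕ) • wedgePair (fun i j => E ![v i, v j]) (fun i j => F ![v i, v j]) := by
  have h := congrArg (fun G => LinearMap.mul' R R (G v))
    (MultilinearMap.domCoprod_alternization_eq E F)
  simp only [Fintype.card_fin, Nat.factorial_two, AlternatingMap.smul_apply, map_nsmul] at h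
  rw [LinearMap.compAlternatingMap_apply]
  refine h.symm.trans ?_
  rw [MultilinearMap.alternatization_apply, map_sum]
  have key : ∀ σ : Equiv.Perm (Fin 4), LinearMap.mul' R R
      (Equiv.Perm.sign ((Equiv.permCongr finSumFinEquiv.symm) σ : Equiv.Perm (Fin 2 ⊕ Fin 2)) •
      (MultilinearMap.domDomCongr (Equiv.permCongr finSumFinEquiv.symm σ)
        ((E : MultilinearMap R (fun _ : Fin 2 => M) R).domCoprod
          (F : MultilinearMap R (fun _ : Fin 2 => M) R))) v) =
      (Equiv.Perm.sign σ : ℤ) • (E ![v (finSumFinEquiv.symm (σ 0)), v (finSumFinEquiv.symm (σ 1))] *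
        F ![v (finSumFinEquiv.symm (σ 2)), v (finSumFinEquiv.symm (σ 3))]) := by
    intro σ
    rw [Equiv.Perm.sign_permCongr, Units.smul_def, map_zsmul]
    congr 1
    simp only [MultilinearMap.domDomCongr_apply, MultilinearMap.domCoprod_apply,
      LinearMap.mul'_apply, AlternatingMap.coe_multilinearMap]
    congr 2
    · funext i; fin_cases i <;> rfl
    · funext i; fin_cases i <;> rfl
  rw [← Equiv.sum_comp (Equiv.permCongr (finSumFinEquiv (m := 2) (n := 2)).symm),
    Finset.sum_congr rfl fun σ _ => key σ]
  have ha := sum_sign_perm_fin_four (fun i j k l =>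
    E ![v (finSumFinEquiv.symm i), v (finSumFinEquiv.symm j)] *
      F ![v (finSumFinEquiv.symm k), v (finSumFinEquiv.symm l)])
    (fun i j k l => by rw [alternating_swap E, neg_mul])
    (fun i j k l => by rw [alternating_swap F, mul_neg])
  rw [ha]
  rfl

theorem compAlternatingMap_domCoprod_apply {R M : Type*} [CommRing R] [IsDomain R] [CharZero R]
    [AddCommGroup M] [Module R M]
    (E F : M [⋀^Fin 2]→ₗ[R] R) (v : Fin 2 ⊕ Fin 2 → M) :
    (LinearMap.mul' R R).compAlternatingMap (E.domCoprod F) v =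
      wedgePair (fun i j => E ![v i, v j]) (fun i j => F ![v i, v j]) := by
  have h := four_smul_domCoprod E F v
  simp only [nsmul_eq_mul] at h
  exact mul_left_cancel₀ (by norm_num) h

/-- The intersection form in terms of an admissible basis. -/
theorem ComplexTwoTorus.intersectionForm_eq (X : ComplexTwoTorus)
    {b : Module.Basis (Fin 2 ⊕ Fin 2) ℤ X.Γ} (hb : X.IsAdmissible b) (E F : X.H2) :
    X.intersectionForm E F = wedgePair (fun i j => E ![b i, b j]) (fun i j => F ![b i, b j]) := by
  rw [← compAlternatingMap_domCoprod_apply]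
  exact X.degree_eq (X.cup E F) hb

section Coordinates

variable {R M N : Type*} [CommRing R] [AddCommGroup M] [Module R M] [AddCommGroup N] [Module R N]

theorem alternating_self (E : M [⋀^Fin 2]→ₗ[R] N) (x : M) : E ![x, x] = 0 :=
  E.map_eq_zero_of_eq _ (i := 0) (j := 1) rfl (by decide)

/-- The wedge product of two linear forms. -/
def wedge (φ ψ : M →ₗ[R] R) : M [⋀^Fin 2]→ₗ[R] R :=
  (Matrix.detRowAlternating (n := Fin 2) (R := R)).compLinearMap (LinearMap.pi ![φ, ψ])

theorem wedge_apply (φ ψ : M →ₗ[R] R) (x y : M) :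
    wedge φ ψ ![x, y] = φ x * ψ y - φ y * ψ x := by
  simp only [wedge, Matrix.detRowAlternating, AlternatingMap.compLinearMap_apply]
  refine (Matrix.det_fin_two _).trans ?_
  simp
  ring

theorem alternating_ext_basis (b : Module.Basis (Fin 2 ⊕ Fin 2) R M)
    {E F : M [⋀^Fin 2]→ₗ[R] N} (h : ∀ i j, E ![b i, b j] = F ![b i, b j]) : E = F := by
  refine Module.Basis.ext_alternating b fun v _ => ?_
  have : (fun i => b (v i)) = ![b (v 0), b (v 1)] := by
    funext i; fin_cases i <;> rfl
  rw [this]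
  exact h _ _

/-- The alternating form with prescribed values on the pairs of basis vectors. -/
def ofCoordinates (b : Module.Basis (Fin 2 ⊕ Fin 2) R M)
    (p : Fin 2 ⊕ Fin 2 → Fin 2 ⊕ Fin 2 → R) : M [⋀^Fin 2]→ₗ[R] R :=
  p (.inl 0) (.inl 1) • wedge (b.coord (.inl 0)) (b.coord (.inl 1)) +
  p (.inl 0) (.inr 0) • wedge (b.coord (.inl 0)) (b.coord (.inr 0)) +
  p (.inl 0) (.inr 1) • wedge (b.coord (.inl 0)) (b.coord (.inr 1)) +
  p (.inl 1) (.inr 0) • wedge (b.coord (.inl 1)) (b.coord (.inr 0)) +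
  p (.inl 1) (.inr 1) • wedge (b.coord (.inl 1)) (b.coord (.inr 1)) +
  p (.inr 0) (.inr 1) • wedge (b.coord (.inr 0)) (b.coord (.inr 1))

theorem ofCoordinates_apply (b : Module.Basis (Fin 2 ⊕ Fin 2) R M)
    {p : Fin 2 ⊕ Fin 2 → Fin 2 ⊕ Fin 2 → R} (hp : ∀ i, p i i = 0) (hp' : ∀ i j, p i j = -p j i)
    (i j : Fin 2 ⊕ Fin 2) : ofCoordinates b p ![b i, b j] = p i j := by
  simp only [ofCoordinates, AlternatingMap.add_apply, AlternatingMap.smul_apply, wedge_apply,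
    Module.Basis.coord_apply, Module.Basis.repr_self]
  have h1 := hp' (.inl 1) (.inl 0)
  have h2 := hp' (.inr 0) (.inl 0)
  have h3 := hp' (.inr 1) (.inl 0)
  have h4 := hp' (.inr 0) (.inl 1)
  have h5 := hp' (.inr 1) (.inl 1)
  have h6 := hp' (.inr 1) (.inr 0)
  rcases i with i | i <;> rcases j with j | j <;> fin_cases i <;> fin_cases j <;>
    simp [hp, h1, h2, h3, h4, h5, h6]

theorem ofCoordinates_self (b : Module.Basis (Fin 2 ⊕ Fin 2) R M) (E : M [⋀^Fin 2]→ₗ[R] R) :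
    ofCoordinates b (fun i j => E ![b i, b j]) = E :=
  alternating_ext_basis b fun i j =>
    ofCoordinates_apply b (fun _ => alternating_self E _) (fun _ _ => alternating_swap E _ _) i j

theorem wedgePair_comm (p q : Fin 2 ⊕ Fin 2 → Fin 2 ⊕ Fin 2 → R) :
    wedgePair p q = wedgePair q p := by
  simp only [wedgePair]; ring

end Coordinates

theorem ComplexTwoTorus.intersectionForm_symm (X : ComplexTwoTorus) (E F : X.H2) :
    X.intersectionForm E F = X.intersectionForm F E := by
  rw [X.intersectionForm_eq X.isAdmissible_admissibleBasis,
    X.intersectionForm_eq X.isAdmissible_admissibleBasis, wedgePair_comm]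

/-- `H²(X, ℤ)` is isometric to `U ⊕ U ⊕ U`. -/
theorem ComplexTwoTorus.exists_isFrame (X : ComplexTwoTorus) :
    ∃ e f : Fin 3 → X.H2, IsFrame X.intersectionForm e f := by
  have hb := X.isAdmissible_admissibleBasis
  set b := X.admissibleBasis
  have hB := X.intersectionForm_eq hb
  have hw : ∀ i j k l, wedge (b.coord i) (b.coord j) ![b k, b l] =
      (if k = i then 1 else 0) * (if l = j then 1 else 0) -
        (if l = i then 1 else 0) * (if k = j then 1 else 0) := by
    intro i j k l
    simp [wedge_apply, Finsupp.single_apply]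
  -- With coordinates 0, 1, 2, 3 the pairs are 01 with 23, 02 with -13, 03 with 12; the signs are
  -- those of the Pfaffian.
  refine ⟨![wedge (b.coord (.inl 0)) (b.coord (.inl 1)),
      wedge (b.coord (.inl 0)) (b.coord (.inr 0)), wedge (b.coord (.inl 0)) (b.coord (.inr 1))],
    ![wedge (b.coord (.inr 0)) (b.coord (.inr 1)),
      -wedge (b.coord (.inl 1)) (b.coord (.inr 1)), wedge (b.coord (.inl 1)) (b.coord (.inr 0))],
    ⟨X.intersectionForm_symm, ?_, ?_, ?_, ?_⟩⟩
  · intro i j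
    rw [hB]
    fin_cases i <;> fin_cases j <;> simp [wedgePair, hw]
  · intro i j
    rw [hB]
    fin_cases i <;> fin_cases j <;> simp [wedgePair, hw]
  · intro i j
    rw [hB]
    fin_cases i <;> fin_cases j <;> simp [wedgePair, hw]
  · intro E
    conv_lhs => rw [← ofCoordinates_self b E]
    simp only [hB, Fin.sum_univ_three]
    simp [wedgePair, hw, ofCoordinates]
    abel

/-! ### Real (1,1)-forms on ℂ² and the Hodge index theorem -/

section StandardForms

open Complex

/-- The standard real basis of `ℂ²`. -/
def realBasis : Module.Basis (Fin 2 ⊕ Fin 2) ℝ (Fin 2 → ℂ) :=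
  Module.Basis.ofEquivFun ComplexTwoTorus.realCoordEquiv

theorem realBasis_coord (v : Fin 2 → ℂ) (i : Fin 2 ⊕ Fin 2) :
    realBasis.coord i v = ComplexTwoTorus.realCoord v i := rfl

theorem realBasis_eq : (realBasis : Fin 2 ⊕ Fin 2 → Fin 2 → ℂ) =
    Sum.elim ![![1, 0], ![I, 0]] ![![0, 1], ![0, I]] := by
  funext i
  rw [realBasis, Module.Basis.coe_ofEquivFun]
  rcases i with i | i <;> fin_cases i <;> funext j <;> fin_cases j <;>
    simp [ComplexTwoTorus.realCoordEquiv, Complex.ext_iff]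

/-- The wedge product of two real `2`-forms on `ℂ²`, as a multiple of the standard volume form. -/
def wedgeReal (A A' : (Fin 2 → ℂ) [⋀^Fin 2]→ₗ[ℝ] ℝ) : ℝ :=
  wedgePair (fun i j => A ![realBasis i, realBasis j]) (fun i j => A' ![realBasis i, realBasis j])

/-- The space of 4-forms on ℂ² is a real line, spanned by the determinant. -/
theorem wedgePair_eq_det_mul (A A' : (Fin 2 → ℂ) [⋀^Fin 2]→ₗ[ℝ] ℝ)
    (v : Fin 2 ⊕ Fin 2 → Fin 2 → ℂ) :
    wedgePair (fun i j => A ![v i, v j]) (fun i j => A' ![v i, v j]) =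
      (Matrix.of fun i j => ComplexTwoTorus.realCoord (v i) j).det * wedgeReal A A' := by
  rw [wedgeReal, ← compAlternatingMap_domCoprod_apply, ← compAlternatingMap_domCoprod_apply]
  have h := congrArg (fun G => G v) (AlternatingMap.eq_smul_basis_det realBasis
    ((LinearMap.mul' ℝ ℝ).compAlternatingMap (A.domCoprod A')))
  refine h.trans ?_
  rw [AlternatingMap.smul_apply, smul_eq_mul, mul_comm, Module.Basis.det_apply,
    ← Matrix.det_transpose]
  rfl

/-- The real part of the form `dz₀ ∧ dz₁`. -/
def reForm : (Fin 2 → ℂ) [⋀^Fin 2]→ₗ[ℝ] ℝ :=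
  wedge (realBasis.coord (.inl 0)) (realBasis.coord (.inr 0)) -
    wedge (realBasis.coord (.inl 1)) (realBasis.coord (.inr 1))

/-- The imaginary part of the form `dz₀ ∧ dz₁`. -/
def imForm : (Fin 2 → ℂ) [⋀^Fin 2]→ₗ[ℝ] ℝ :=
  wedge (realBasis.coord (.inl 0)) (realBasis.coord (.inr 1)) +
    wedge (realBasis.coord (.inl 1)) (realBasis.coord (.inr 0))

theorem reForm_apply (v w : Fin 2 → ℂ) : reForm ![v, w] = (v 0 * w 1 - w 0 * v 1).re := by
  simp only [reForm, AlternatingMap.sub_apply, wedge_apply, realBasis_coord,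
    ComplexTwoTorus.realCoord]
  simp
  ring

theorem imForm_apply (v w : Fin 2 → ℂ) : imForm ![v, w] = (v 0 * w 1 - w 0 * v 1).im := by
  simp only [imForm, AlternatingMap.add_apply, wedge_apply, realBasis_coord,
    ComplexTwoTorus.realCoord]
  simp
  ring

theorem wedgeReal_reForm (A : (Fin 2 → ℂ) [⋀^Fin 2]→ₗ[ℝ] ℝ) :
    wedgeReal A reForm = A ![realBasis (.inl 0), realBasis (.inr 0)] -
      A ![realBasis (.inl 1), realBasis (.inr 1)] := by
  simp [wedgeReal, wedgePair, reForm_apply, realBasis_eq]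

theorem wedgeReal_imForm (A : (Fin 2 → ℂ) [⋀^Fin 2]→ₗ[ℝ] ℝ) :
    wedgeReal A imForm = A ![realBasis (.inl 0), realBasis (.inr 1)] +
      A ![realBasis (.inl 1), realBasis (.inr 0)] := by
  simp [wedgeReal, wedgePair, imForm_apply, realBasis_eq]

theorem wedgeReal_reForm_self : wedgeReal reForm reForm = 2 := by
  rw [wedgeReal_reForm]
  simp [reForm_apply, realBasis_eq]
  norm_num

open ComplexTwoTorus in
theorem apply_eq_coord (A : (Fin 2 → ℂ) [⋀^Fin 2]→ₗ[ℝ] ℝ) (v w : Fin 2 → ℂ) :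
    A ![v, w] =
      A ![realBasis (.inl 0), realBasis (.inl 1)] *
        ((v 0).re * (w 0).im - (w 0).re * (v 0).im) +
      A ![realBasis (.inl 0), realBasis (.inr 0)] *
        ((v 0).re * (w 1).re - (w 0).re * (v 1).re) +
      A ![realBasis (.inl 0), realBasis (.inr 1)] *
        ((v 0).re * (w 1).im - (w 0).re * (v 1).im) +
      A ![realBasis (.inl 1), realBasis (.inr 0)] *
        ((v 0).im * (w 1).re - (w 0).im * (v 1).re) +
      A ![realBasis (.inl 1), realBasis (.inr 1)] *
        ((v 0).im * (w 1).im - (w 0).im * (v 1).im) +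
      A ![realBasis (.inr 0), realBasis (.inr 1)] *
        ((v 1).re * (w 1).im - (w 1).re * (v 1).im) := by
  conv_lhs => rw [← ofCoordinates_self realBasis A]
  simp only [ofCoordinates, AlternatingMap.add_apply, AlternatingMap.smul_apply, wedge_apply,
    realBasis_coord, realCoord, smul_eq_mul]
  simp

/-- Being of type (1,1) means being orthogonal to the period dz₀ ∧ dz₁; in coordinates, A₀₂ = A₁₃
and A₀₃ = -A₁₂. This makes the type a linear condition that the period map can prescribe. -/
theorem isType11_iff (A : (Fin 2 → ℂ) [⋀^Fin 2]→ₗ[ℝ] ℝ) :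
    ComplexTwoTorus.IsType11 A ↔ wedgeReal A reForm = 0 ∧ wedgeReal A imForm = 0 := by
  rw [wedgeReal_reForm, wedgeReal_imForm]
  constructor
  · intro h
    have h1 := h (realBasis (.inl 0)) (realBasis (.inr 0))
    have h2 := h (realBasis (.inl 0)) (realBasis (.inr 1))
    rw [apply_eq_coord A (I • _)] at h1 h2
    simp [realBasis_eq] at h1 h2 ⊢
    constructor <;> linarith
  · rintro ⟨h1, h2⟩ v w
    rw [apply_eq_coord A (I • v), apply_eq_coord A v]
    simp only [Pi.smul_apply, smul_eq_mul, mul_re, mul_im, I_re, I_im]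
    linear_combination (-(v 0).re * (w 1).re + (w 0).re * (v 1).re + (v 0).im * (w 1).im
      - (w 0).im * (v 1).im) * h1 +
      (-(v 0).re * (w 1).im + (w 0).re * (v 1).im - (v 0).im * (w 1).re +
        (w 0).im * (v 1).re) * h2

/-- A real form is positive if the associated Hermitian form is positive definite. -/
def IsPositive (A : (Fin 2 → ℂ) [⋀^Fin 2]→ₗ[ℝ] ℝ) : Prop :=
  ∀ v : Fin 2 → ℂ, v ≠ 0 → 0 < A ![I • v, v]

variable {A A' : (Fin 2 → ℂ) [⋀^Fin 2]→ₗ[ℝ] ℝ}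

/-- On the four remaining coordinates this polarizes 2(ad - b² - c²), twice the determinant of the
Hermitian matrix, a form of signature (1,3). -/
theorem wedgeReal_of_isType11 (hA : ComplexTwoTorus.IsType11 A)
    (hA' : ComplexTwoTorus.IsType11 A') : wedgeReal A A' =
      A ![realBasis (.inl 0), realBasis (.inl 1)] * A' ![realBasis (.inr 0), realBasis (.inr 1)] +
      A ![realBasis (.inr 0), realBasis (.inr 1)] * A' ![realBasis (.inl 0), realBasis (.inl 1)] -
      2 * (A ![realBasis (.inl 0), realBasis (.inr 0)] *
        A' ![realBasis (.inl 0), realBasis (.inr 0)]) -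
      2 * (A ![realBasis (.inl 0), realBasis (.inr 1)] *
        A' ![realBasis (.inl 0), realBasis (.inr 1)]) := by
  rw [isType11_iff, wedgeReal_reForm, wedgeReal_imForm] at hA hA'
  rw [wedgeReal, wedgePair, eq_neg_of_add_eq_zero_right hA.2, eq_neg_of_add_eq_zero_right hA'.2,
    ← sub_eq_zero.mp hA.1, ← sub_eq_zero.mp hA'.1]
  ring

theorem hermitian_apply_of_isType11 (hA : ComplexTwoTorus.IsType11 A) (v : Fin 2 → ℂ) :
    A ![I • v, v] =
      -A ![realBasis (.inl 0), realBasis (.inl 1)] * ((v 0).re ^ 2 + (v 0).im ^ 2) -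
      A ![realBasis (.inr 0), realBasis (.inr 1)] * ((v 1).re ^ 2 + (v 1).im ^ 2) +
      2 * A ![realBasis (.inl 0), realBasis (.inr 0)] *
        ((v 0).re * (v 1).im - (v 0).im * (v 1).re) -
      2 * A ![realBasis (.inl 0), realBasis (.inr 1)] *
        ((v 0).re * (v 1).re + (v 0).im * (v 1).im) := by
  rw [isType11_iff, wedgeReal_reForm, wedgeReal_imForm] at hA
  rw [apply_eq_coord, eq_neg_of_add_eq_zero_right hA.2, ← sub_eq_zero.mp hA.1]
  simp only [Pi.smul_apply, smul_eq_mul, mul_re, mul_im, I_re, I_im]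
  ring

theorem IsPositive.wedgeReal_pos (hA : ComplexTwoTorus.IsType11 A) (h : IsPositive A) :
    0 < wedgeReal A A := by
  rw [wedgeReal_of_isType11 hA hA]
  have h1 := h ![0, 1] (by simp)
  rw [hermitian_apply_of_isType11 hA] at h1
  simp at h1
  set a := A ![realBasis (.inl 0), realBasis (.inl 1)]
  set d := A ![realBasis (.inr 0), realBasis (.inr 1)]
  set b := A ![realBasis (.inl 0), realBasis (.inr 0)]
  set c := A ![realBasis (.inl 0), realBasis (.inr 1)]
  -- This vector is Hermitian-orthogonal to (0, 1), and its value is -d times the determinant ad -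
  -- b² - c².
  have h2 := h ![⟨-d, 0⟩, ⟨c, -b⟩] (fun h => by
    have := congrArg re (congrFun h 0)
    simp at this
    linarith)
  rw [hermitian_apply_of_isType11 hA] at h2
  simp at h2
  have h3 : 0 < -d * (a * d - b ^ 2 - c ^ 2) := by
    simp only [a, b, c, d] at h2 ⊢
    linarith
  have h4 := pos_of_mul_pos_right h3 (by linarith)
  linarith

theorem isPositive_of_wedgeReal_pos (hA : ComplexTwoTorus.IsType11 A) (h : 0 < wedgeReal A A)
    (ha : A ![realBasis (.inl 0), realBasis (.inl 1)] < 0) : IsPositive A := by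
  intro v hv
  rw [wedgeReal_of_isType11 hA hA] at h
  rw [hermitian_apply_of_isType11 hA]
  generalize A ![realBasis (.inl 0), realBasis (.inl 1)] = a at *
  generalize A ![realBasis (.inr 0), realBasis (.inr 1)] = d at *
  generalize A ![realBasis (.inl 0), realBasis (.inr 0)] = b at *
  generalize A ![realBasis (.inl 0), realBasis (.inr 1)] = c at *
  set x₀ := (v 0).re with hx₀
  set y₀ := (v 0).im with hy₀
  set x₁ := (v 1).re with hx₁
  set y₁ := (v 1).im with hy₁
  have hdisc : 0 < a * d - b ^ 2 - c ^ 2 := by linarith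
  refine pos_of_mul_pos_right (a := -a) ?_ (by linarith)
  -- Completing the square in the variable z₀.
  have key : -a * (-a * (x₀ ^ 2 + y₀ ^ 2) - d * (x₁ ^ 2 + y₁ ^ 2) +
      2 * b * (x₀ * y₁ - y₀ * x₁) - 2 * c * (x₀ * x₁ + y₀ * y₁)) =
      (a * x₀ - b * y₁ + c * x₁) ^ 2 + (a * y₀ + b * x₁ + c * y₁) ^ 2 +
        (a * d - b ^ 2 - c ^ 2) * (x₁ ^ 2 + y₁ ^ 2) := by ring
  rw [key]
  by_cases h1 : v 1 = 0
  · have h0 : v 0 ≠ 0 := fun h0 => hv (by funext i; fin_cases i <;> assumption)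
    have e1 : x₁ = 0 := by rw [hx₁, h1, zero_re]
    have e2 : y₁ = 0 := by rw [hy₁, h1, zero_im]
    have h2 : 0 < x₀ ^ 2 + y₀ ^ 2 := by
      have := normSq_pos.mpr h0
      rw [normSq_apply] at this
      linarith
    rw [e1, e2]
    have := mul_pos (sq_pos_of_neg ha) h2
    linarith
  · have h2 : 0 < x₁ ^ 2 + y₁ ^ 2 := by
      have := normSq_pos.mpr h1
      rw [normSq_apply] at this
      linarith
    have := mul_pos hdisc h2
    positivity

theorem wedgeReal_neg_neg (A : (Fin 2 → ℂ) [⋀^Fin 2]→ₗ[ℝ] ℝ) :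
    wedgeReal (-A) (-A) = wedgeReal A A := by
  simp [wedgeReal, wedgePair]

/-- A form of type `(1,1)` with positive square is definite. -/
theorem isPositive_or_neg (hA : ComplexTwoTorus.IsType11 A) (h : 0 < wedgeReal A A) :
    IsPositive A ∨ IsPositive (-A) := by
  have hA' : ComplexTwoTorus.IsType11 (-A) := fun v w => congrArg Neg.neg (hA v w)
  rcases lt_trichotomy (A ![realBasis (.inl 0), realBasis (.inl 1)]) 0 with ha | ha | ha
  · exact .inl (isPositive_of_wedgeReal_pos hA h ha)
  · rw [wedgeReal_of_isType11 hA hA, ha] at h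
    nlinarith [sq_nonneg (A ![realBasis (.inl 0), realBasis (.inr 0)]),
      sq_nonneg (A ![realBasis (.inl 0), realBasis (.inr 1)])]
  · refine .inr (isPositive_of_wedgeReal_pos hA' (by rwa [wedgeReal_neg_neg]) ?_)
    rw [AlternatingMap.neg_apply]
    linarith

/-- The Hodge index theorem for forms of type `(1,1)`. -/
theorem wedgeReal_neg_or_eq_zero (hA : ComplexTwoTorus.IsType11 A)
    (hA' : ComplexTwoTorus.IsType11 A') (h : 0 < wedgeReal A A) (h0 : wedgeReal A A' = 0) :
    wedgeReal A' A' < 0 ∨ A' = 0 := by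
  by_contra! hcon
  obtain ⟨h1, hne⟩ := hcon
  have hA'' := hA'
  rw [wedgeReal_of_isType11 hA hA] at h
  rw [wedgeReal_of_isType11 hA hA'] at h0
  rw [wedgeReal_of_isType11 hA' hA'] at h1
  rw [isType11_iff, wedgeReal_reForm, wedgeReal_imForm] at hA''
  apply hne
  generalize A ![realBasis (.inl 0), realBasis (.inl 1)] = a at *
  generalize A ![realBasis (.inr 0), realBasis (.inr 1)] = d at *
  generalize A ![realBasis (.inl 0), realBasis (.inr 0)] = b at *
  generalize A ![realBasis (.inl 0), realBasis (.inr 1)] = c at *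
  have hzero : A' ![realBasis (.inl 0), realBasis (.inl 1)] = 0 ∧
      A' ![realBasis (.inr 0), realBasis (.inr 1)] = 0 ∧
      A' ![realBasis (.inl 0), realBasis (.inr 0)] = 0 ∧
      A' ![realBasis (.inl 0), realBasis (.inr 1)] = 0 := by
    generalize A' ![realBasis (.inl 0), realBasis (.inl 1)] = a' at *
    generalize A' ![realBasis (.inr 0), realBasis (.inr 1)] = d' at *
    generalize A' ![realBasis (.inl 0), realBasis (.inr 0)] = b' at *
    generalize A' ![realBasis (.inl 0), realBasis (.inr 1)] = c' at *
    have hdisc : 0 < a * d - b ^ 2 - c ^ 2 := by linarith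
    have had : 0 < a * d := by nlinarith [sq_nonneg b, sq_nonneg c]
    -- Reversed Cauchy–Schwarz: ad(b'² + c'²) ≤ ad·a'd' ≤ ((ad' + da')/2)² = (bb' + cc')² ≤ (b² +
    -- c²)(b'² + c'²).
    have hle : (a * d - b ^ 2 - c ^ 2) * (b' ^ 2 + c' ^ 2) ≤ 0 := by
      have e1 : a * d' + d * a' = 2 * (b * b' + c * c') := by linarith
      have e2 : (a * d' + d * a') ^ 2 = 4 * (b * b' + c * c') ^ 2 := by rw [e1]; ring
      have e3 : 0 ≤ a * d * (a' * d' - b' ^ 2 - c' ^ 2) := mul_nonneg had.le (by linarith)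
      nlinarith [sq_nonneg (a * d' - d * a'), sq_nonneg (b * c' - c * b')]
    have hbc : b' ^ 2 + c' ^ 2 = 0 :=
      le_antisymm (nonpos_of_mul_nonpos_right hle hdisc) (by positivity)
    have hb' : b' = 0 := by nlinarith [sq_nonneg b', sq_nonneg c']
    have hc' : c' = 0 := by nlinarith [sq_nonneg b', sq_nonneg c']
    subst hb' hc'
    have e1 : a * d' = -(d * a') := by linarith
    have e2 : 0 ≤ a' * d' := by linarith
    have hd : d ≠ 0 := right_ne_zero_of_mul had.ne'
    have ha : a ≠ 0 := left_ne_zero_of_mul had.ne'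
    have e3 : (d * a') ^ 2 ≤ 0 := by
      have : a * d * (a' * d') = -(d * a') ^ 2 := by
        calc a * d * (a' * d') = (a * d') * (d * a') := by ring
          _ = _ := by rw [e1]; ring
      nlinarith [mul_nonneg had.le e2]
    have e4 : d * a' = 0 := by nlinarith [sq_nonneg (d * a')]
    have ha' : a' = 0 := (mul_eq_zero.mp e4).resolve_left hd
    rw [e4, neg_zero] at e1
    exact ⟨ha', (mul_eq_zero.mp e1).resolve_left ha, rfl, rfl⟩
  obtain ⟨z1, z2, z3, z4⟩ := hzero
  rw [z3, z4, zero_sub, zero_add, neg_eq_zero] at hA''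
  rw [← ofCoordinates_self realBasis A']
  simp [ofCoordinates, z1, z2, z3, z4, hA''.1, hA''.2]

end StandardForms

end Wedge

end MirrorAbelian

end

noncomputable section

namespace MirrorAbelian

/-! ### From real forms to integral classes -/

namespace ComplexTwoTorus

variable (X : ComplexTwoTorus)

theorem exists_isRealExtension (E : X.H2) : ∃ A, X.IsRealExtension E A := by
  set b := X.admissibleBasis with hb
  let b' := b.ofZLatticeBasis ℝ X.Γ
  have hb' : ∀ i, b' i = (b i : Fin 2 → ℂ) := fun i => b.ofZLatticeBasis_apply ℝ X.Γ i
  let A := ofCoordinates b' fun i j => (E ![b i, b j] : ℝ)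
  have hA : ∀ i j, A ![b' i, b' j] = E ![b i, b j] := ofCoordinates_apply b'
    (fun i => by rw [alternating_self, Int.cast_zero])
    (fun i j => by rw [alternating_swap, Int.cast_neg])
  refine ⟨A, fun x y => ?_⟩
  let A₀ : (Fin 2 → ℂ) [⋀^Fin 2]→ₗ[ℤ] ℝ :=
    { A.toMultilinearMap.restrictScalars ℤ with
      map_eq_zero_of_eq' := fun v _ _ h hij => A.map_eq_zero_of_eq v h hij }
  have key : A₀.compLinearMap X.Γ.subtype =
      ((Int.castAddHom ℝ).toIntLinearMap).compAlternatingMap E := by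
    refine alternating_ext_basis b fun i j => ?_
    have := hA i j
    rw [hb', hb'] at this
    refine Eq.trans ?_ this
    rw [AlternatingMap.compLinearMap_apply]
    refine congrArg A ?_
    funext k; fin_cases k <;> rfl
  have h := congrArg (fun G => G ![x, y]) key
  refine Eq.trans ?_ h
  rw [AlternatingMap.compLinearMap_apply]
  refine congrArg A ?_
  funext k; fin_cases k <;> rfl

variable {X} {E F : X.H2} {A A' : (Fin 2 → ℂ) [⋀^Fin 2]→ₗ[ℝ] ℝ}

theorem IsRealExtension.unique (hA : X.IsRealExtension E A) (hA' : X.IsRealExtension E A') :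
    A = A' := by
  refine alternating_ext_basis (X.admissibleBasis.ofZLatticeBasis ℝ X.Γ) fun i j => ?_
  rw [X.admissibleBasis.ofZLatticeBasis_apply ℝ, X.admissibleBasis.ofZLatticeBasis_apply ℝ, hA, hA']

theorem IsRealExtension.mem_NS_iff (hA : X.IsRealExtension E A) : E ∈ X.NS ↔ IsType11 A :=
  ⟨fun ⟨_, hB, hB'⟩ => hA.unique hB ▸ hB', fun h => ⟨A, hA, h⟩⟩

theorem wedgePair_intCast (p q : Fin 2 ⊕ Fin 2 → Fin 2 ⊕ Fin 2 → ℤ) :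
    ((wedgePair p q : ℤ) : ℝ) = wedgePair (fun i j => (p i j : ℝ)) (fun i j => (q i j : ℝ)) := by
  simp [wedgePair]

/-- The factor is the positive covolume of the lattice, so signs and orthogonality pass between
integral classes and real forms. -/
theorem IsRealExtension.intersectionForm_eq (hA : X.IsRealExtension E A)
    (hA' : X.IsRealExtension F A') : (X.intersectionForm E F : ℝ) =
      (Matrix.of fun i j => realCoord (X.admissibleBasis i : Fin 2 → ℂ) j).det *
        wedgeReal A A' := by
  rw [X.intersectionForm_eq X.isAdmissible_admissibleBasis, wedgePair_intCast,
    ← wedgePair_eq_det_mul]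
  simp only [hA _ _, hA' _ _]

theorem mem_NS_of_smul_mem {n : ℤ} (hn : n ≠ 0) (h : n • E ∈ X.NS) : E ∈ X.NS := by
  obtain ⟨A, hA, hA'⟩ := h
  have hn' : (n : ℝ) ≠ 0 := by exact_mod_cast hn
  refine ⟨(n : ℝ)⁻¹ • A, fun x y => ?_, fun v w => ?_⟩
  · rw [AlternatingMap.smul_apply, hA x y]
    simp [hn']
  · rw [AlternatingMap.smul_apply, AlternatingMap.smul_apply, hA' v w]

theorem IsPolarization.mem_NS (h : X.IsPolarization E) : E ∈ X.NS := by
  obtain ⟨A, hA, hA', -⟩ := h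
  exact ⟨A, hA, hA'⟩

theorem IsPolarization.intersectionForm_pos (h : X.IsPolarization E) :
    0 < X.intersectionForm E E := by
  obtain ⟨A, hA, hA', hpos⟩ := h
  have := mul_pos X.isAdmissible_admissibleBasis (IsPositive.wedgeReal_pos hA' hpos)
  rw [← hA.intersectionForm_eq hA] at this
  exact_mod_cast this

theorem isPolarization_or_neg (h : E ∈ X.NS) (hE : 0 < X.intersectionForm E E) :
    X.IsPolarization E ∨ X.IsPolarization (-E) := by
  obtain ⟨A, hA, hA'⟩ := h
  have h1 : (0 : ℝ) < X.intersectionForm E E := by exact_mod_cast hE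
  rw [hA.intersectionForm_eq hA] at h1
  rcases isPositive_or_neg hA' (pos_of_mul_pos_right h1 X.isAdmissible_admissibleBasis.le)
    with h2 | h2
  · exact .inl ⟨A, hA, hA', h2⟩
  · refine .inr ⟨-A, fun x y => ?_, fun v w => congrArg Neg.neg (hA' v w), h2⟩
    simp [hA x y]

/-- The Hodge index theorem. -/
theorem intersectionForm_neg_or_eq_zero (hE : E ∈ X.NS) (hF : F ∈ X.NS)
    (h : 0 < X.intersectionForm E E) (h0 : X.intersectionForm E F = 0) :
    X.intersectionForm F F < 0 ∨ F = 0 := by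
  obtain ⟨A, hA, hA1⟩ := hE
  obtain ⟨A', hA', hA1'⟩ := hF
  have hD := X.isAdmissible_admissibleBasis
  unfold IsAdmissible at hD
  have h1 : (0 : ℝ) < X.intersectionForm E E := by exact_mod_cast h
  have h2 : (X.intersectionForm E F : ℝ) = 0 := by exact_mod_cast h0
  rw [hA.intersectionForm_eq hA] at h1
  rw [hA.intersectionForm_eq hA'] at h2
  rcases wedgeReal_neg_or_eq_zero hA1 hA1' (pos_of_mul_pos_right h1 hD.le)
    ((mul_eq_zero.mp h2).resolve_left hD.ne') with h3 | h3
  · left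
    have := mul_neg_of_pos_of_neg hD h3
    rw [← hA'.intersectionForm_eq hA'] at this
    exact_mod_cast this
  · right
    refine alternating_ext_basis X.admissibleBasis fun i j => ?_
    have := hA' (X.admissibleBasis i) (X.admissibleBasis j)
    rw [h3, AlternatingMap.zero_apply] at this
    exact_mod_cast this.symm

end ComplexTwoTorus

/-! ### Decomposable forms and surjectivity of the period map -/

/-- A `2`-form satisfying the Plücker relation is decomposable. -/
theorem exists_decomposition {K : Type*} [Field K] (σ : Fin 2 ⊕ Fin 2 → Fin 2 ⊕ Fin 2 → K)
    (h : ∀ i, σ i i = 0) (h' : ∀ i j, σ i j = -σ j i)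
    (hσ : σ (.inl 0) (.inl 1) * σ (.inr 0) (.inr 1) - σ (.inl 0) (.inr 0) * σ (.inl 1) (.inr 1) +
      σ (.inl 0) (.inr 1) * σ (.inl 1) (.inr 0) = 0) :
    ∃ a c : Fin 2 ⊕ Fin 2 → K, ∀ i j, a i * c j - a j * c i = σ i j := by
  by_cases h0 : ∀ i j, σ i j = 0
  · exact ⟨0, 0, fun i j => by simp [h0]⟩
  push Not at h0
  obtain ⟨k, l, hkl⟩ := h0
  -- The two factors are contractions of σ with basis vectors k, l for which σ k l ≠ 0; `key`
  -- collects the resulting consequences of the Plücker relation.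
  refine ⟨fun i => σ k i, fun i => σ l i / σ k l, fun i j => ?_⟩
  have h1 := h' (.inl 1) (.inl 0)
  have h2 := h' (.inr 0) (.inl 0)
  have h3 := h' (.inr 1) (.inl 0)
  have h4 := h' (.inr 0) (.inl 1)
  have h5 := h' (.inr 1) (.inl 1)
  have h6 := h' (.inr 1) (.inr 0)
  have key : ∀ k l i j, σ k i * σ l j - σ k j * σ l i = σ i j * σ k l := by
    clear hkl
    intro k l i j
    rcases k with k | k <;> rcases l with l | l <;> rcases i with i | i <;> rcases j with j | j <;>
    fin_cases k <;> fin_cases l <;> fin_cases i <;> fin_cases j <;>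
    simp only [Fin.zero_eta, Fin.mk_one, h, h1, h2, h3, h4, h5, h6] <;>
    first | ring1 | linear_combination hσ | linear_combination -hσ
  rw [mul_div_assoc', mul_div_assoc', ← sub_div, key, mul_div_assoc, div_self hkl, mul_one]

open ComplexTwoTorus in
/-- Surjectivity of the period map. -/
theorem exists_torus_of_period (X : ComplexTwoTorus)
    {b : Module.Basis (Fin 2 ⊕ Fin 2) ℤ X.Γ} (hb : X.IsAdmissible b)
    (r s : Fin 2 ⊕ Fin 2 → Fin 2 ⊕ Fin 2 → ℝ) (hr : ∀ i, r i i = 0) (hs : ∀ i, s i i = 0)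
    (hr' : ∀ i j, r i j = -r j i) (hs' : ∀ i j, s i j = -s j i)
    (hpos : 0 < wedgePair r r) (hrs : wedgePair r r = wedgePair s s) (h0 : wedgePair r s = 0) :
    ∃ (Y : ComplexTwoTorus) (Φ : X.H2 ≃ₗ[ℤ] Y.H2),
      (∀ E F, Y.intersectionForm (Φ E) (Φ F) = X.intersectionForm E F) ∧
      ∀ E, Φ E ∈ Y.NS ↔ wedgePair (fun i j => (E ![b i, b j] : ℝ)) r = 0 ∧
        wedgePair (fun i j => (E ![b i, b j] : ℝ)) s = 0 := by
  -- The hypotheses r² = s² and r·s = 0 say that σ = r + is has σ ∧ σ = 0, so σ = a ∧ c. The lattice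
  -- spanned by the vectors (aᵢ, cᵢ) in ℂ² has dz₀ ∧ dz₁ restricting to σ.
  obtain ⟨a, c, hac⟩ := exists_decomposition (fun i j => (⟨r i j, s i j⟩ : ℂ))
    (fun i => by simp [hr, hs, Complex.ext_iff])
    (fun i j => by rw [hr' i j, hs' i j]; simp [Complex.ext_iff]) (by
      simp only [wedgePair] at hrs h0
      apply Complex.ext
      · simp
        linarith
      · simp
        linarith)
  let v : Fin 2 ⊕ Fin 2 → Fin 2 → ℂ := fun i => ![a i, c i]
  have hvr : ∀ i j, reForm ![v i, v j] = r i j := by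
    intro i j
    rw [reForm_apply]
    exact congrArg Complex.re (hac i j)
  have hvs : ∀ i j, imForm ![v i, v j] = s i j := by
    intro i j
    rw [imForm_apply]
    exact congrArg Complex.im (hac i j)
  set D := (Matrix.of fun i j => realCoord (v i) j).det with hD
  -- Squaring Re(dz₀ ∧ dz₁) on these vectors gives r² = 2D, so r² > 0 yields a positively oriented
  -- real basis.
  have hDpos : 0 < D := by
    have := wedgePair_eq_det_mul reForm reForm v
    simp only [hvr, wedgeReal_reForm_self] at this
    linarith
  have hdet : realBasis.det v = D := by
    rw [hD, ← Matrix.det_transpose, Module.Basis.det_apply]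
    rfl
  have hunit : IsUnit (realBasis.det v) := by rw [hdet]; exact hDpos.ne'.isUnit
  obtain ⟨hli, hsp⟩ := (Module.Basis.is_basis_iff_det realBasis).mpr hunit
  let B : Module.Basis (Fin 2 ⊕ Fin 2) ℝ (Fin 2 → ℂ) := Module.Basis.mk hli hsp.ge
  have hB : ∀ i, B i = v i := fun i => by rw [Module.Basis.mk_apply]
  let Y : ComplexTwoTorus := ⟨Submodule.span ℤ (Set.range B), inferInstance, inferInstance⟩
  let y : Module.Basis (Fin 2 ⊕ Fin 2) ℤ Y.Γ := B.restrictScalars ℤ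
  have hy : ∀ i, (y i : Fin 2 → ℂ) = v i := fun i => by
    rw [← hB]; exact B.restrictScalars_apply ℤ i
  have hyadm : Y.IsAdmissible y := by
    unfold IsAdmissible
    simp only [hy]
    exact hDpos
  let ψ : Y.Γ ≃ₗ[ℤ] X.Γ := y.equiv b (Equiv.refl _)
  let Φ : X.H2 ≃ₗ[ℤ] Y.H2 := AlternatingMap.domLCongr ℤ ℤ (Fin 2) ℤ ψ.symm
  have hΦ : ∀ (E : X.H2) i j, (Φ E) ![y i, y j] = E ![b i, b j] := by
    intro E i j
    refine congrArg E ?_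
    funext k
    fin_cases k
    · exact y.equiv_apply i b (Equiv.refl _)
    · exact y.equiv_apply j b (Equiv.refl _)
  refine ⟨Y, Φ, fun E F => ?_, fun E => ?_⟩
  · rw [Y.intersectionForm_eq hyadm, X.intersectionForm_eq hb]
    simp only [hΦ]
  · obtain ⟨A, hA⟩ := Y.exists_isRealExtension (Φ E)
    have hA' : ∀ i j, A ![v i, v j] = (E ![b i, b j] : ℝ) := by
      intro i j
      rw [← hy, ← hy, hA, hΦ]
    rw [hA.mem_NS_iff, isType11_iff]
    have h1 := wedgePair_eq_det_mul A reForm v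
    have h2 := wedgePair_eq_det_mul A imForm v
    simp only [hvr, hvs, hA'] at h1 h2
    rw [h1, h2, mul_eq_zero, mul_eq_zero, or_iff_right hDpos.ne', or_iff_right hDpos.ne']

end MirrorAbelian

end

noncomputable section

/-! ### Mirror triples and orthogonality in H² -/

namespace MirrorAbelian

/-- Powers of a transcendental number. These coefficients will make a real period generic, so that
one real orthogonality splits into many integral ones. -/
theorem exists_linearIndependent_with_one (n : ℕ) : ∃ β : Fin n → ℝ, ∀ (c₀ : ℤ) (c : Fin n → ℤ),
    (c₀ : ℝ) + ∑ k, β k * c k = 0 → c₀ = 0 ∧ ∀ k, c k = 0 := by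
  have ht : Transcendental ℤ (liouvilleNumber ((2 : ℕ) : ℝ)) := transcendental_liouvilleNumber le_rfl
  set x := liouvilleNumber ((2 : ℕ) : ℝ)
  refine ⟨fun k => x ^ ((k : ℕ) + 1), fun c₀ c h => ?_⟩
  let p : Polynomial ℤ := Polynomial.C c₀ + ∑ k : Fin n, Polynomial.monomial ((k : ℕ) + 1) (c k)
  have hp : p = 0 := by
    by_contra hp0
    refine ht ⟨p, hp0, ?_⟩
    rw [← h]
    simp [p, Polynomial.aeval_monomial, mul_comm]
  refine ⟨?_, fun k => ?_⟩
  · have := congrArg (fun q => Polynomial.coeff q 0) hp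
    simpa [p, Polynomial.finsetSum_coeff, Polynomial.coeff_monomial] using this
  · have := congrArg (fun q => Polynomial.coeff q ((k : ℕ) + 1)) hp
    simp only [p, Polynomial.coeff_add, Polynomial.coeff_C_succ] at this
    simpa [Polynomial.finsetSum_coeff, Polynomial.coeff_monomial, Fin.val_inj] using this

/-- The wedge product in coordinates as a bilinear form. -/
def wedgeBilin : LinearMap.BilinForm ℝ (Fin 2 ⊕ Fin 2 → Fin 2 ⊕ Fin 2 → ℝ) :=
  LinearMap.mk₂ ℝ wedgePair
    (fun p p' q => by simp only [wedgePair, Pi.add_apply]; ring)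
    (fun c p q => by simp only [wedgePair, Pi.smul_apply, smul_eq_mul]; ring)
    (fun p q q' => by simp only [wedgePair, Pi.add_apply]; ring)
    (fun c p q => by simp only [wedgePair, Pi.smul_apply, smul_eq_mul]; ring)

theorem wedgeBilin_apply (p q : Fin 2 ⊕ Fin 2 → Fin 2 ⊕ Fin 2 → ℝ) :
    wedgeBilin p q = wedgePair p q := rfl

theorem wedgeBilin_comm (p q : Fin 2 ⊕ Fin 2 → Fin 2 ⊕ Fin 2 → ℝ) :
    wedgeBilin p q = wedgeBilin q p := wedgePair_comm p q

theorem exists_smul_mem_range {N W : Type*} [AddCommGroup N] [AddCommGroup W]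
    [Module.Finite ℤ W] {κ : N →ₗ[ℤ] W} (hκ : Function.Injective κ)
    (h : Module.finrank ℤ N = Module.finrank ℤ W) (w : W) :
    ∃ n : ℤ, n ≠ 0 ∧ n • w ∈ LinearMap.range κ := by
  have h1 := Submodule.finrank_quotient_add_finrank (LinearMap.range κ)
  rw [LinearMap.finrank_range_of_inj hκ, h] at h1
  have h2 : Module.finrank ℤ (W ⧸ LinearMap.range κ) = 0 := by omega
  obtain ⟨n, hn, hn'⟩ := Module.finrank_eq_zero_iff.mp h2 (Submodule.Quotient.mk w)
  refine ⟨n, hn, ?_⟩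
  rwa [← Submodule.Quotient.mk_smul, Submodule.Quotient.mk_eq_zero] at hn'

theorem IsFrame.injective {L : Type*} [AddCommGroup L] {B : LinearMap.BilinForm ℤ L}
    {e f : Fin 3 → L} (h : IsFrame B e f) {x : L} (hx : ∀ y, B x y = 0) : x = 0 := by
  rw [h.expand x]
  simp [hx]

instance (X : ComplexTwoTorus) : Module.Finite ℤ X.H2 := by
  obtain ⟨e, f, h⟩ := X.exists_isFrame
  classical
  refine ⟨⟨Finset.univ.image e ∪ Finset.univ.image f, eq_top_iff.mpr fun x _ => ?_⟩⟩
  rw [h.expand x]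
  refine Submodule.sum_mem _ fun i _ => Submodule.add_mem _ (Submodule.smul_mem _ _ ?_)
    (Submodule.smul_mem _ _ ?_)
  · exact Submodule.subset_span (by simp)
  · exact Submodule.subset_span (by simp)

namespace AbelianSurface

variable (X : AbelianSurface)

theorem mem_T_iff {x : X.H2} : x ∈ X.T ↔ ∀ D ∈ X.NS, X.intersectionForm D x = 0 :=
  LinearMap.BilinForm.mem_orthogonal_iff

/-- `e, f` is a hyperbolic pair in the transcendental lattice, and `m` a vector of positive square
in its orthogonal complement in the transcendental lattice. -/
structure IsMirrorTriple (e f m : X.H2) : Prop where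
  e_mem : e ∈ X.T
  f_mem : f ∈ X.T
  m_mem : m ∈ X.T
  ee : X.intersectionForm e e = 0
  ff : X.intersectionForm f f = 0
  ef : X.intersectionForm e f = 1
  me : X.intersectionForm m e = 0
  mf : X.intersectionForm m f = 0
  mm : 0 < X.intersectionForm m m

theorem exists_positive : ∃ h ∈ X.NS, 0 < X.intersectionForm h h := by
  obtain ⟨h, hh⟩ := X.exists_polarization
  exact ⟨h, hh.mem_NS, hh.intersectionForm_pos⟩

variable {X}

theorem exists_isMirrorTriple_of_equivalent {Y : AbelianSurface}
    (h : X.formT.Equivalent Y.formN) : ∃ e f m, X.IsMirrorTriple e f m := by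
  obtain ⟨φ⟩ := h
  obtain ⟨E, hE, hE'⟩ := Y.exists_positive
  -- The sign offsets the one in the Mukai pairing: (-1, 0, 0)·(0, 0, 1) = 1.
  let x : Y.N := ⟨(-1, 0, 0), trivial, Y.NS.zero_mem, trivial⟩
  let y : Y.N := ⟨(0, 0, 1), trivial, Y.NS.zero_mem, trivial⟩
  let z : Y.N := ⟨(0, E, 0), trivial, hE, trivial⟩
  have hφ : ∀ u v : Y.N, X.intersectionForm (φ.symm u : X.T) (φ.symm v : X.T) =
      Y.mukaiForm u v := fun u v => φ.symm.map_app v u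
  refine ⟨(φ.symm x : X.T), (φ.symm y : X.T), (φ.symm z : X.T), ⟨Subtype.mem _, Subtype.mem _,
    Subtype.mem _, ?_, ?_, ?_, ?_, ?_, ?_⟩⟩ <;> rw [hφ]
  · simp [mukaiForm, x]
  · simp [mukaiForm, y]
  · simp [mukaiForm, x, y]
  · simp [mukaiForm, x, z]
  · simp [mukaiForm, z, y]
  · simpa [mukaiForm, z] using hE'

/-- The pair e, f splits off T(X) and becomes H⁰ ⊕ H⁴, while the orthogonal projection away from it
goes to NS(Y): x ↦ (-x·f, Φ(x - (x·f)e - (x·e)f), x·e). It serves both isometries of a mirror pair,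
with Φ and with its inverse. -/
theorem formT_equivalent_formN {Y : AbelianSurface} (Φ : X.H2 ≃ₗ[ℤ] Y.H2)
    (hΦ : ∀ E F, Y.intersectionForm (Φ E) (Φ F) = X.intersectionForm E F) {e f : X.H2}
    (ee : X.intersectionForm e e = 0) (ff : X.intersectionForm f f = 0)
    (ef : X.intersectionForm e f = 1)
    (hT : ∀ x, x ∈ X.T ↔ Φ (x - X.intersectionForm x f • e - X.intersectionForm x e • f) ∈ Y.NS)
    (horth : ∀ x, Φ x ∈ Y.NS → X.intersectionForm x e = 0 ∧ X.intersectionForm x f = 0) :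
    X.formT.Equivalent Y.formN := by
  have fe : X.intersectionForm f e = 1 := by rw [X.intersectionForm_symm, ef]
  have hinv : ∀ y : Y.N, X.intersectionForm (Φ.symm y.1.2.1) e = 0 ∧
      X.intersectionForm (Φ.symm y.1.2.1) f = 0 := fun y =>
    horth _ (by rw [Φ.apply_symm_apply]; exact y.2.2.1)
  have h1 : ∀ y : Y.N, X.intersectionForm (-y.1.1 • e + y.1.2.2 • f + Φ.symm y.1.2.1) e =
      y.1.2.2 := fun y => by simp [ee, fe, (hinv y).1]
  have h2 : ∀ y : Y.N, X.intersectionForm (-y.1.1 • e + y.1.2.2 • f + Φ.symm y.1.2.1) f =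
      -y.1.1 := fun y => by simp [ff, ef, (hinv y).2]
  have h3 : ∀ y : Y.N, (-y.1.1 • e + y.1.2.2 • f + Φ.symm y.1.2.1) - (-y.1.1) • e -
      y.1.2.2 • f = Φ.symm y.1.2.1 := fun y => by module
  let π : X.H2 →ₗ[ℤ] X.H2 := LinearMap.id -
    (X.intersectionForm.flip f).smulRight e - (X.intersectionForm.flip e).smulRight f
  let ψ : X.H2 →ₗ[ℤ] Y.Hev := (-X.intersectionForm.flip f).prod
    ((Φ.toLinearMap ∘ₗ π).prod (X.intersectionForm.flip e))
  let φ : X.T ≃ₗ[ℤ] Y.N :=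
    { (ψ.domRestrict X.T).codRestrict Y.N fun x => ⟨trivial, (hT x).mp x.2, trivial⟩ with
      invFun := fun y => ⟨-y.1.1 • e + y.1.2.2 • f + Φ.symm y.1.2.1, by
        rw [hT, h1, h2, h3, Φ.apply_symm_apply]
        exact y.2.2.1⟩
      left_inv := fun x => by
        refine Subtype.ext ?_
        change -(-X.intersectionForm x f) • e + X.intersectionForm x e • f +
          Φ.symm (Φ (x - X.intersectionForm x f • e - X.intersectionForm x e • f)) = (x : X.H2)
        rw [Φ.symm_apply_apply]
        module
      right_inv := fun y => by
        refine Subtype.ext (Prod.ext ?_ (Prod.ext ?_ ?_))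
        · exact (congrArg Neg.neg (h2 y)).trans (neg_neg _)
        · change Φ ((-y.1.1 • e + y.1.2.2 • f + Φ.symm y.1.2.1) -
            X.intersectionForm (-y.1.1 • e + y.1.2.2 • f + Φ.symm y.1.2.1) f • e -
            X.intersectionForm (-y.1.1 • e + y.1.2.2 • f + Φ.symm y.1.2.1) e • f) = y.1.2.1
          rw [h1, h2, h3, Φ.apply_symm_apply]
        · exact h1 y }
  refine ⟨⟨φ, fun x y => ?_⟩⟩
  change Y.intersectionForm
      (Φ (x - X.intersectionForm x f • e - X.intersectionForm x e • f))
      (Φ (y - X.intersectionForm y f • e - X.intersectionForm y e • f)) -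
    -X.intersectionForm x f * X.intersectionForm y e -
    X.intersectionForm x e * -X.intersectionForm y f = X.intersectionForm x y
  rw [hΦ]
  simp only [map_sub, map_smul, LinearMap.sub_apply, LinearMap.smul_apply, smul_eq_mul, ee, ff, ef,
    fe, X.intersectionForm_symm e y, X.intersectionForm_symm f y]
  ring

theorem formNS_nondegenerate {D : X.H2} (hD : D ∈ X.NS)
    (h : ∀ E ∈ X.NS, X.intersectionForm D E = 0) : D = 0 := by
  obtain ⟨H, hH, hpos⟩ := X.exists_positive
  rcases X.intersectionForm_neg_or_eq_zero hH hD hpos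
    (by rw [X.intersectionForm_symm]; exact h H hH) with h1 | h1
  · rw [h D hD] at h1
    exact absurd h1 (lt_irrefl 0)
  · exact h1

/-- Up to a multiple, every class is the sum of a class in `NS(X)` and one orthogonal to it. -/
theorem exists_smul_sub_orthogonal (x : X.H2) : ∃ n : ℤ, n ≠ 0 ∧ ∃ s ∈ X.NS,
    ∀ D ∈ X.NS, X.intersectionForm (n • x - s) D = 0 := by
  let κ : X.NS →ₗ[ℤ] Module.Dual ℤ X.NS :=
    ((Module.Dual.transpose X.NS.subtype).comp X.intersectionForm).comp X.NS.subtype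
  have hκ : ∀ D E : X.NS, κ D E = X.intersectionForm D E := fun D E => rfl
  have hinj : Function.Injective κ := by
    rw [injective_iff_map_eq_zero]
    intro D hD
    refine Subtype.ext (formNS_nondegenerate D.2 fun E hE => ?_)
    rw [← hκ D ⟨E, hE⟩, hD, LinearMap.zero_apply]
  obtain ⟨n, hn, s, hs⟩ := exists_smul_mem_range hinj
    (Module.finrank_linearMap_self ℤ ℤ X.NS).symm (X.intersectionForm x ∘ₗ X.NS.subtype)
  refine ⟨n, hn, s, s.2, fun D hD => ?_⟩
  have := congrArg (fun g => g ⟨D, hD⟩) hs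
  simp only [hκ, LinearMap.smul_apply, LinearMap.comp_apply, Submodule.subtype_apply] at this
  rw [map_sub, map_smul, LinearMap.sub_apply, LinearMap.smul_apply, this, sub_self]

/-- `NS(X)` is the double orthogonal complement of itself inside the complement of a hyperbolic
plane in `T(X)`. -/
theorem mem_NS_of_orthogonal {e f : X.H2} (he : e ∈ X.T) (hf : f ∈ X.T)
    (ee : X.intersectionForm e e = 0) (ff : X.intersectionForm f f = 0)
    (ef : X.intersectionForm e f = 1) {x : X.H2} (hxe : X.intersectionForm x e = 0)
    (hxf : X.intersectionForm x f = 0)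
    (hx : ∀ m ∈ X.T, X.intersectionForm m e = 0 → X.intersectionForm m f = 0 →
      X.intersectionForm m x = 0) : x ∈ X.NS := by
  rw [mem_T_iff] at he hf
  have fe : X.intersectionForm f e = 1 := by rw [X.intersectionForm_symm, ef]
  obtain ⟨n, hn, s, hs, h⟩ := exists_smul_sub_orthogonal x
  have hme : X.intersectionForm (n • x - s) e = 0 := by simp [hxe, he s hs]
  have hmf : X.intersectionForm (n • x - s) f = 0 := by simp [hxf, hf s hs]
  -- This class is orthogonal to e, f, NS(X) and every admissible m. Up to a multiple each y is a
  -- sum of such classes, so the class pairs to zero with all of H² and vanishes.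
  have hzero : n • x - s = 0 := by
    obtain ⟨_, _, hframe⟩ := X.exists_isFrame
    refine hframe.injective fun y => ?_
    obtain ⟨k, hk, s', hs', h'⟩ := exists_smul_sub_orthogonal
      (y - X.intersectionForm y f • e - X.intersectionForm y e • f)
    obtain ⟨m, hm⟩ : ∃ m, m = k • (y - X.intersectionForm y f • e -
      X.intersectionForm y e • f) - s' := ⟨_, rfl⟩
    rw [← hm] at h'
    have hm0 : X.intersectionForm m x = 0 := by
      refine hx m (X.mem_T_iff.mpr fun D hD => by rw [X.intersectionForm_symm, h' D hD]) ?_ ?_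
      · simp [hm, ee, fe, he s' hs']
      · simp [hm, ff, ef, hf s' hs']
    have h1 : X.intersectionForm (n • x - s) m = 0 := by
      rw [X.intersectionForm_symm, map_sub, map_smul, hm0, h' s hs]
      simp
    have h2 : k * X.intersectionForm (n • x - s) y = 0 := by
      have h3 : X.intersectionForm (n • x - s) (k • (y - X.intersectionForm y f • e -
        X.intersectionForm y e • f)) = X.intersectionForm (n • x - s) (m + s') := by
          rw [hm, sub_add_cancel]
      rw [map_add, h1, h s' hs', map_smul, map_sub, map_sub, map_smul, map_smul, hme, hmf] at h3
      simpa using h3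
    exact (mul_eq_zero.mp h2).resolve_left hk
  refine X.mem_NS_of_smul_mem hn ?_
  rw [sub_eq_zero.mp hzero]
  exact hs

end AbelianSurface

end MirrorAbelian

end

noncomputable section

namespace MirrorAbelian

/-! ### Construction of the mirror partner -/

namespace AbelianSurface

variable {X : AbelianSurface}

/-- There is a torus whose Néron–Severi lattice is the complement of a hyperbolic plane in the
transcendental lattice of `X`. -/
theorem exists_torus_of_hyperbolicPair {e f : X.H2} (he : e ∈ X.T) (hf : f ∈ X.T)
    (ee : X.intersectionForm e e = 0) (ff : X.intersectionForm f f = 0)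
    (ef : X.intersectionForm e f = 1) :
    ∃ (Y : ComplexTwoTorus) (Φ : X.H2 ≃ₗ[ℤ] Y.H2),
      (∀ E F, Y.intersectionForm (Φ E) (Φ F) = X.intersectionForm E F) ∧
      ∀ E, Φ E ∈ Y.NS ↔ E ∈ X.T ∧ X.intersectionForm E e = 0 ∧ X.intersectionForm E f = 0 := by
  rw [mem_T_iff] at he hf
  obtain ⟨h, hh, hpos⟩ := X.exists_positive
  set b := X.admissibleBasis
  have hb : X.IsAdmissible b := X.isAdmissible_admissibleBasis
  let g := Module.finBasis ℤ X.NS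
  obtain ⟨β, hβ⟩ := exists_linearIndependent_with_one (Module.finrank ℤ X.NS)
  have hg : ∀ E : X.H2, (∀ k, X.intersectionForm E (g k) = 0) →
      ∀ D ∈ X.NS, X.intersectionForm E D = 0 := by
    intro E hE D hD
    have : X.intersectionForm E ∘ₗ X.NS.subtype = 0 := g.ext fun k => hE k
    exact congrArg (fun φ => φ ⟨D, hD⟩) this
  let ρ : X.H2 → Fin 2 ⊕ Fin 2 → Fin 2 ⊕ Fin 2 → ℝ := fun E i j => (E ![b i, b j] : ℝ)
  have hρ : ∀ E F, wedgeBilin (ρ E) (ρ F) = X.intersectionForm E F := by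
    intro E F
    rw [X.intersectionForm_eq hb, ComplexTwoTorus.wedgePair_intCast]
    rfl
  have hρ0 : ∀ E i, ρ E i i = 0 := fun E i => by simp [ρ, alternating_self]
  have hρ1 : ∀ E i j, ρ E i j = -ρ E j i := fun E i j => by
    simp only [ρ]; rw [alternating_swap, Int.cast_neg]
  obtain ⟨z, hz⟩ : ∃ z, z = ∑ k, β k • ρ (g k) := ⟨_, rfl⟩
  have hEz : ∀ E, wedgeBilin (ρ E) z = ∑ k, β k * X.intersectionForm E (g k) := by
    intro E
    simp only [hz, map_sum, map_smul, smul_eq_mul, hρ]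
  have hze : wedgeBilin (ρ e) z = 0 := by
    rw [hEz]
    exact Finset.sum_eq_zero fun k _ => by
      rw [X.intersectionForm_symm, he _ (g k).2, Int.cast_zero, mul_zero]
  have hzf : wedgeBilin (ρ f) z = 0 := by
    rw [hEz]
    exact Finset.sum_eq_zero fun k _ => by
      rw [X.intersectionForm_symm, hf _ (g k).2, Int.cast_zero, mul_zero]
  have hz0 : ∀ i, z i i = 0 := fun i => by simp [hz, hρ0]
  have hz1 : ∀ i j, z i j = -z j i := fun i j => by
    simp only [hz, Finset.sum_apply, Pi.smul_apply, ← Finset.sum_neg_distrib]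
    exact Finset.sum_congr rfl fun k _ => by rw [hρ1, smul_neg]
  have hee : wedgeBilin (ρ e) (ρ e) = 0 := by rw [hρ, ee, Int.cast_zero]
  have hff : wedgeBilin (ρ f) (ρ f) = 0 := by rw [hρ, ff, Int.cast_zero]
  have hef : wedgeBilin (ρ e) (ρ f) = 1 := by rw [hρ, ef, Int.cast_one]
  have hhe : wedgeBilin (ρ h) (ρ e) = 0 := by rw [hρ, he h hh, Int.cast_zero]
  have hhf : wedgeBilin (ρ h) (ρ f) = 0 := by rw [hρ, hf h hh, Int.cast_zero]
  have hhpos : 0 < wedgeBilin (ρ h) (ρ h) := by rw [hρ]; exact_mod_cast hpos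
  -- The period is r + is, where z is a generic real combination of a basis of NS(X). The value of t
  -- gives r² = h², and the multiple of f subtracted in s gives r·s = 0 without changing s² = h².
  obtain ⟨t, ht⟩ : ∃ t, t = (wedgeBilin (ρ h) (ρ h) - wedgeBilin z z) / 2 := ⟨_, rfl⟩
  let r := ρ e + z + t • ρ f
  let s := ρ h - wedgeBilin (ρ h) z • ρ f
  have hrr : wedgeBilin r r = wedgeBilin (ρ h) (ρ h) := by
    simp only [r, map_add, map_smul, LinearMap.add_apply, LinearMap.smul_apply, smul_eq_mul, hee,
      hff, hef, hze, hzf, wedgeBilin_comm z (ρ e), wedgeBilin_comm z (ρ f),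
      wedgeBilin_comm (ρ f) (ρ e), ht]
    ring
  have hss : wedgeBilin s s = wedgeBilin (ρ h) (ρ h) := by
    simp only [s, map_sub, map_smul, LinearMap.sub_apply, LinearMap.smul_apply, smul_eq_mul,
      hff, hhf, wedgeBilin_comm (ρ f) (ρ h)]
    ring
  have hrs : wedgeBilin r s = 0 := by
    simp only [r, s, map_add, map_sub, map_smul, LinearMap.add_apply, LinearMap.smul_apply,
      smul_eq_mul, hff, hef, hhe, hhf, hzf, wedgeBilin_comm z (ρ f), wedgeBilin_comm z (ρ h),
      wedgeBilin_comm (ρ e) (ρ h), wedgeBilin_comm (ρ f) (ρ h)]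
    ring
  obtain ⟨Y, Φ, hΦ, hNS⟩ := exists_torus_of_period X.toComplexTwoTorus hb r s
    (fun i => by simp [r, hρ0, hz0]) (fun i => by simp [s, hρ0])
    (fun i j => by
      simp only [r, Pi.add_apply, Pi.smul_apply, smul_eq_mul, hρ1 _ i j, hz1 i j]; ring)
    (fun i j => by simp only [s, Pi.sub_apply, Pi.smul_apply, smul_eq_mul, hρ1 _ i j]; ring)
    (by rw [← wedgeBilin_apply, hrr]; exact hhpos)
    (by rw [← wedgeBilin_apply, ← wedgeBilin_apply, hrr, hss]) hrs
  refine ⟨Y, Φ, hΦ, fun E => (hNS E).trans ?_⟩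
  have hEr : wedgeBilin (ρ E) r = X.intersectionForm E e +
      ∑ k, β k * X.intersectionForm E (g k) + t * X.intersectionForm E f := by
    simp only [r, map_add, map_smul, smul_eq_mul, hρ, hEz]
  have hEs : wedgeBilin (ρ E) s = X.intersectionForm E h +
      ∑ k, β k * ((-(X.intersectionForm E f * X.intersectionForm h (g k)) : ℤ) : ℝ) := by
    simp only [s, map_sub, map_smul, smul_eq_mul, hρ, hEz]
    rw [sub_eq_add_neg, Finset.sum_mul, ← Finset.sum_neg_distrib]
    congr 1
    refine Finset.sum_congr rfl fun k _ => ?_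
    push_cast
    ring
  change wedgeBilin (ρ E) r = 0 ∧ wedgeBilin (ρ E) s = 0 ↔ _
  rw [hEr, hEs]
  constructor
  -- Genericity of β in E·s = 0 gives (E·f)(h·gₖ) = 0 for all k; not all h·gₖ vanish, as h² > 0, so
  -- E·f = 0. Then E·r = 0 separates into E·e = 0 and E·gₖ = 0.
  · rintro ⟨h1, h2⟩
    obtain ⟨-, h3⟩ := hβ _ _ h2
    have hEf : X.intersectionForm E f = 0 := by
      by_contra hne
      refine hpos.ne' (hg h (fun k => ?_) h hh)
      exact (mul_eq_zero.mp (neg_eq_zero.mp (h3 k))).resolve_left hne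
    rw [hEf, Int.cast_zero, mul_zero, add_zero] at h1
    obtain ⟨h4, h5⟩ := hβ _ _ h1
    exact ⟨X.mem_T_iff.mpr fun D hD => by rw [X.intersectionForm_symm]; exact hg E h5 D hD,
      h4, hEf⟩
  · rintro ⟨h1, h2, h3⟩
    rw [mem_T_iff] at h1
    have h4 : ∀ D ∈ X.NS, X.intersectionForm E D = 0 := fun D hD => by
      rw [X.intersectionForm_symm, h1 D hD]
    have h5 : ∀ k, X.intersectionForm E (g k) = 0 := fun k => h4 _ (g k).2
    simp [h2, h3, h4 h hh, h5]

theorem IsMirrorTriple.exists_mirrorPartners {e f m : X.H2} (h : X.IsMirrorTriple e f m) :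
    ∃ Y, X.MirrorPartners Y := by
  obtain ⟨Z, Φ, hΦ, hNS⟩ := exists_torus_of_hyperbolicPair h.e_mem h.f_mem h.ee h.ff h.ef
  have hpol : ∃ E, Z.IsPolarization E := by
    have h1 : Φ m ∈ Z.NS := (hNS m).mpr ⟨h.m_mem, h.me, h.mf⟩
    rcases Z.isPolarization_or_neg h1 (by rw [hΦ]; exact h.mm) with h2 | h2
    · exact ⟨_, h2⟩
    · exact ⟨_, h2⟩
  let Y : AbelianSurface := ⟨Z, hpol⟩
  have he := X.mem_T_iff.mp h.e_mem
  have hf := X.mem_T_iff.mp h.f_mem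
  have fe : X.intersectionForm f e = 1 := by rw [X.intersectionForm_symm, h.ef]
  refine ⟨Y, formT_equivalent_formN (Y := Y) Φ hΦ h.ee h.ff h.ef (fun x => ?_)
    (fun x hx => ((hNS x).mp hx).2), LinearMap.BilinForm.Equivalent.symm ?_⟩
  · refine Iff.trans ?_ (hNS _).symm
    rw [mem_T_iff, mem_T_iff]
    constructor
    · intro hx
      refine ⟨fun D hD => by simp [hx D hD, he D hD, hf D hD], ?_, ?_⟩
      · simp [h.ee, fe]
      · simp [h.ff, h.ef]
    · rintro ⟨hx, -, -⟩ D hD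
      have := hx D hD
      simpa [he D hD, hf D hD] using this
  · have hΦ' : ∀ E F, X.intersectionForm (Φ.symm E) (Φ.symm F) = Z.intersectionForm E F := by
      intro E F
      rw [← hΦ, Φ.apply_symm_apply, Φ.apply_symm_apply]
    have hYe : ∀ y, Z.intersectionForm y (Φ e) = X.intersectionForm (Φ.symm y) e := fun y => by
      rw [← hΦ', Φ.symm_apply_apply]
    have hYf : ∀ y, Z.intersectionForm y (Φ f) = X.intersectionForm (Φ.symm y) f := fun y => by
      rw [← hΦ', Φ.symm_apply_apply]
    refine formT_equivalent_formN (X := Y) (Y := X) (e := Φ e) (f := Φ f) Φ.symm hΦ'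
      ((hΦ _ _).trans h.ee) ((hΦ _ _).trans h.ff) ((hΦ _ _).trans h.ef) (fun y => ?_)
      (fun y hy => ?_)
    · rw [mem_T_iff]
      obtain ⟨x, rfl⟩ := Φ.surjective y
      have hx' : Φ.symm (Φ x - Y.intersectionForm (Φ x) (Φ f) • Φ e -
          Y.intersectionForm (Φ x) (Φ e) • Φ f) =
          x - X.intersectionForm x f • e - X.intersectionForm x e • f := by
        have e1 : Y.intersectionForm (Φ x) (Φ f) = X.intersectionForm x f := hΦ _ _
        have e2 : Y.intersectionForm (Φ x) (Φ e) = X.intersectionForm x e := hΦ _ _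
        rw [e1, e2]
        simp only [map_sub, map_smul, Φ.symm_apply_apply]
      rw [hx']
      constructor
      · intro hx
        refine mem_NS_of_orthogonal h.e_mem h.f_mem h.ee h.ff h.ef ?_ ?_ fun n hn hne hnf => ?_
        · simp [h.ee, fe]
        · simp [h.ff, h.ef]
        · have h1 : X.intersectionForm n x = 0 :=
            (hΦ n x).symm.trans (hx (Φ n) ((hNS n).mpr ⟨hn, hne, hnf⟩))
          simp [h1, hne, hnf]
      · intro hx D hD
        obtain ⟨n, rfl⟩ := Φ.surjective D
        obtain ⟨hn, hne, hnf⟩ := (hNS n).mp hD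
        have h1 := (X.mem_T_iff.mp hn) _ hx
        rw [X.intersectionForm_symm] at h1
        refine (hΦ n x).trans ?_
        simpa [hne, hnf] using h1
    · refine ⟨(hYe y).trans ?_, (hYf y).trans ?_⟩
      · exact he _ hy
      · exact hf _ hy

/-! ### Mirror triples and the Picard number -/

theorem IsMirrorTriple.picardNumber_le {e f m : X.H2} (h : X.IsMirrorTriple e f m) :
    X.picardNumber ≤ 3 ∧ (X.picardNumber = 3 → ∃ n : ℕ, 0 < n ∧
      X.formNS.Equivalent (orthogonalSum (rankOneForm (-2 * (n : ℤ))) hyperbolicPlane)) := by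
  obtain ⟨E₀, F₀, hEF₀⟩ := X.exists_isFrame
  obtain ⟨E₁, F₁, hEF₁, rfl, rfl⟩ := hEF₀.exists_first_pair h.ee h.ff h.ef
  obtain ⟨E, F, hEF, hE, hF, hm1, hm2, l, hl⟩ := hEF₁.exists_reduced m
  rw [← hE, ← hF] at h
  clear hE hF hEF₁ hEF₀ E₁ F₁ E₀ F₀
  obtain ⟨α, hα⟩ : ∃ α, α = X.intersectionForm m (E 1) := ⟨_, rfl⟩
  rw [← hα] at hl
  have hmx : ∀ x, X.intersectionForm m x =
      α * (l * X.intersectionForm x (E 1) + X.intersectionForm x (F 1)) := by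
    intro x
    rw [hEF.apply_eq, hm1, hm2, h.me, h.mf, hl, ← hα]
    ring
  have hsq : 0 < 2 * α ^ 2 * l := by
    have := h.mm
    rw [hmx m, hl, ← hα] at this
    linarith
  have hα0 : α ≠ 0 := by rintro rfl; simp at hsq
  have hl0 : 0 < l := pos_of_mul_pos_right hsq (by positivity)
  have hNS : ∀ x ∈ X.NS, X.intersectionForm x (E 0) = 0 ∧ X.intersectionForm x (F 0) = 0 ∧
      X.intersectionForm x (F 1) = -l * X.intersectionForm x (E 1) := by
    intro x hx
    refine ⟨X.mem_T_iff.mp h.e_mem x hx, X.mem_T_iff.mp h.f_mem x hx, ?_⟩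
    have h1 := X.mem_T_iff.mp h.m_mem x hx
    rw [X.intersectionForm_symm, hmx] at h1
    have := (mul_eq_zero.mp h1).resolve_left hα0
    linarith
  let κ : X.NS →ₗ[ℤ] ℤ × (Fin 2 → ℤ) :=
    ((X.intersectionForm.flip (E 1)).prod (LinearMap.pi
      ![X.intersectionForm.flip (F 2), X.intersectionForm.flip (E 2)])) ∘ₗ X.NS.subtype
  have hκ1 : ∀ x : X.NS, (κ x).1 = X.intersectionForm x (E 1) := fun x => rfl
  have hκ2 : ∀ x : X.NS, (κ x).2 0 = X.intersectionForm x (F 2) := fun x => rfl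
  have hκ3 : ∀ x : X.NS, (κ x).2 1 = X.intersectionForm x (E 2) := fun x => rfl
  have hexp : ∀ x : X.NS, (x : X.H2) = (κ x).1 • (F 1 - l • E 1) + (κ x).2 0 • E 2 +
      (κ x).2 1 • F 2 := by
    intro x
    obtain ⟨h1, h2, h3⟩ := hNS x x.2
    conv_lhs => rw [hEF.expand' x, h1, h2, h3]
    rw [hκ1, hκ2, hκ3]
    module
  have hinj : Function.Injective κ := by
    intro x y hxy
    refine Subtype.ext ?_
    rw [hexp x, hexp y, hxy]
  have hrank : Module.finrank ℤ (ℤ × (Fin 2 → ℤ)) = 3 := by simp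
  refine ⟨?_, fun h3 => ⟨l.toNat, by omega, ?_⟩⟩
  · rw [← hrank]
    exact LinearMap.finrank_le_finrank_of_injective hinj
  · have hsurj : Function.Surjective κ := by
      intro w
      -- Equal ranks give finite index in ℤ(-2l) ⊕ U, and saturation of NS(X) makes the index one.
      obtain ⟨n, hn, x, hx⟩ := exists_smul_mem_range hinj (h3.trans hrank.symm) w
      have hy : w.1 • (F 1 - l • E 1) + w.2 0 • E 2 + w.2 1 • F 2 ∈ X.NS := by
        refine X.mem_NS_of_smul_mem hn ?_
        convert x.2 using 1
        rw [hexp x, hx]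
        simp only [Prod.smul_fst, Prod.smul_snd, Pi.smul_apply, smul_eq_mul]
        module
      refine ⟨⟨_, hy⟩, Prod.ext ?_ (funext fun i => ?_)⟩
      · rw [hκ1]
        simp [hEF.ee, hEF.fe]
      · fin_cases i
        · refine (hκ2 _).trans ?_
          simp [hEF.ef, hEF.ff]
        · refine (hκ3 _).trans ?_
          simp [hEF.ee, hEF.fe]
    refine ⟨⟨LinearEquiv.ofBijective κ ⟨hinj, hsurj⟩, fun x y => ?_⟩⟩
    change orthogonalSum _ _ (κ x) (κ y) = X.intersectionForm x y
    obtain ⟨h1, h2, h3⟩ := hNS x x.2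
    obtain ⟨h1', h2', h3'⟩ := hNS y y.2
    rw [hEF.apply_eq, h1, h2, h3, h1', h2', h3', ← hκ1, ← hκ2, ← hκ3, ← hκ1, ← hκ2, ← hκ3]
    simp [orthogonalSum, rankOneForm, hyperbolicPlane, Matrix.toBilin'_apply, Fin.sum_univ_two,
      Int.toNat_of_nonneg hl0.le]
    ring

/-- In a frame whose first plane is the summand U of NS(X), the generator w of square -2n reduces to
α(l E₁ + F₁) with l < 0. Then E₂, F₂ and F₁ - l E₁, of square -2l > 0, are orthogonal to NS(X). -/
theorem exists_isMirrorTriple_of_picardNumber_eq_three {n : ℕ} (hn : 0 < n)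
    (h : X.formNS.Equivalent
      (orthogonalSum (rankOneForm (-2 * (n : ℤ))) hyperbolicPlane)) :
    ∃ e f m, X.IsMirrorTriple e f m := by
  obtain ⟨φ⟩ := h
  have hφ : ∀ u v, X.intersectionForm (φ.symm u : X.NS) (φ.symm v : X.NS) =
      orthogonalSum (rankOneForm (-2 * (n : ℤ))) hyperbolicPlane u v :=
    fun u v => φ.symm.map_app v u
  obtain ⟨u, hu⟩ : ∃ u : X.H2, u = (φ.symm (0, ![1, 0]) : X.NS) := ⟨_, rfl⟩
  obtain ⟨v, hv⟩ : ∃ v : X.H2, v = (φ.symm (0, ![0, 1]) : X.NS) := ⟨_, rfl⟩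
  obtain ⟨w, hw⟩ : ∃ w : X.H2, w = (φ.symm (1, 0) : X.NS) := ⟨_, rfl⟩
  have huu : X.intersectionForm u u = 0 := by
    rw [hu, hφ]; simp [orthogonalSum, rankOneForm, hyperbolicPlane, Matrix.toBilin'_apply]
  have hvv : X.intersectionForm v v = 0 := by
    rw [hv, hφ]; simp [orthogonalSum, rankOneForm, hyperbolicPlane, Matrix.toBilin'_apply]
  have huv : X.intersectionForm u v = 1 := by
    rw [hu, hv, hφ]; simp [orthogonalSum, rankOneForm, hyperbolicPlane, Matrix.toBilin'_apply]
  have hwu : X.intersectionForm w u = 0 := by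
    rw [hw, hu, hφ]; simp [orthogonalSum, rankOneForm, hyperbolicPlane]
  have hwv : X.intersectionForm w v = 0 := by
    rw [hw, hv, hφ]; simp [orthogonalSum, rankOneForm, hyperbolicPlane]
  have hww : X.intersectionForm w w = -2 * n := by
    rw [hw, hφ]; simp [orthogonalSum, rankOneForm, hyperbolicPlane]
  have hspan : ∀ D ∈ X.NS, ∃ a b c : ℤ, D = a • w + b • u + c • v := by
    intro D hD
    refine ⟨(φ ⟨D, hD⟩).1, (φ ⟨D, hD⟩).2 0, (φ ⟨D, hD⟩).2 1, ?_⟩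
    have h1 : φ ⟨D, hD⟩ = (φ ⟨D, hD⟩).1 • ((1, 0) : ℤ × (Fin 2 → ℤ)) +
        (φ ⟨D, hD⟩).2 0 • (0, ![1, 0]) + (φ ⟨D, hD⟩).2 1 • (0, ![0, 1]) := by
      refine Prod.ext ?_ (funext fun i => ?_)
      · simp
      · fin_cases i <;> simp
    have h2 := congrArg φ.symm h1
    rw [map_add, map_add, map_smul, map_smul, map_smul] at h2
    have h3 : φ.symm (φ ⟨D, hD⟩) = ⟨D, hD⟩ := φ.toLinearEquiv.symm_apply_apply _
    rw [h3] at h2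
    rw [hu, hv, hw]
    exact congrArg Subtype.val h2
  obtain ⟨E₀, F₀, hEF₀⟩ := X.exists_isFrame
  obtain ⟨E₁, F₁, hEF₁, rfl, rfl⟩ := hEF₀.exists_first_pair huu hvv huv
  obtain ⟨E, F, hEF, hE, hF, hw1, hw2, l, hl⟩ := hEF₁.exists_reduced w
  rw [← hE] at hspan hwu
  rw [← hF] at hspan hwv
  clear huu hvv huv hu hv hE hF
  obtain ⟨α, hα⟩ : ∃ α, α = X.intersectionForm w (E 1) := ⟨_, rfl⟩
  rw [← hα] at hl
  have hwx : ∀ x, X.intersectionForm w x =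
      α * (l * X.intersectionForm x (E 1) + X.intersectionForm x (F 1)) := by
    intro x
    rw [hEF.apply_eq, hw1, hw2, hwu, hwv, hl, ← hα]
    ring
  have hlneg : l < 0 := by
    have h1 : 2 * α ^ 2 * l < 0 := by
      have := hwx w
      rw [hl, ← hα, hww] at this
      have hn' : (0 : ℤ) < n := by exact_mod_cast hn
      linarith
    exact neg_of_mul_neg_right h1 (by positivity)
  have hT : ∀ x, X.intersectionForm (E 0) x = 0 → X.intersectionForm (F 0) x = 0 →
      X.intersectionForm w x = 0 → x ∈ X.T := by
    intro x h1 h2 h3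
    rw [mem_T_iff]
    intro D hD
    obtain ⟨a, b, c, rfl⟩ := hspan D hD
    simp [h1, h2, h3]
  refine ⟨E 2, F 2, F 1 - l • E 1, ⟨hT _ ?_ ?_ ?_, hT _ ?_ ?_ ?_, hT _ ?_ ?_ ?_, ?_, ?_, ?_, ?_, ?_,
    ?_⟩⟩ <;> simp [hwx, hEF.ee, hEF.ff, hEF.ef, hEF.fe]
  omega

/-- The classes orthogonal to a polarization are spanned up to multiples by one class, if the
Picard number is at most two. -/
theorem exists_orthogonal_of_picardNumber_le_two (hX : X.picardNumber ≤ 2) {h : X.H2}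
    (hh : h ∈ X.NS) (hpos : 0 < X.intersectionForm h h) :
    ∃ g ∈ X.NS, X.intersectionForm h g = 0 ∧ ∀ x, X.intersectionForm h x = 0 →
      X.intersectionForm g x = 0 → x ∈ X.T := by
  by_cases hP : ∃ g ∈ X.NS, X.intersectionForm h g = 0 ∧ g ≠ 0
  · obtain ⟨g, hg, hhg, hg0⟩ := hP
    refine ⟨g, hg, hhg, fun x hhx hgx => X.mem_T_iff.mpr fun D hD => ?_⟩
    have hdep : ¬LinearIndependent ℤ ![(⟨h, hh⟩ : X.NS), ⟨g, hg⟩, ⟨D, hD⟩] := by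
      intro hli
      have := hli.fintype_card_le_finrank
      rw [Fintype.card_fin] at this
      exact absurd (this.trans hX) (by norm_num)
    rw [Fintype.not_linearIndependent_iff] at hdep
    obtain ⟨c, hc, hc0⟩ := hdep
    rw [Fin.sum_univ_three] at hc
    have hc' : c 0 • h + c 1 • g + c 2 • D = 0 := congrArg Subtype.val hc
    have h2 : c 2 ≠ 0 := by
      intro h2
      have h3 := congrArg (X.intersectionForm h) hc'
      simp only [h2, map_add, map_smul, hhg, map_zero, smul_eq_mul, mul_zero, zero_mul,
        add_zero] at h3
      have h4 := (mul_eq_zero.mp h3).resolve_right hpos.ne'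
      rw [h2, h4, zero_smul, zero_smul, zero_add, add_zero] at hc'
      have h5 := (smul_eq_zero.mp hc').resolve_right hg0
      obtain ⟨i, hi⟩ := hc0
      fin_cases i
      · exact hi h4
      · exact hi h5
      · exact hi h2
    have h3 := congrArg (fun y => X.intersectionForm y x) hc'
    simp only [map_add, map_smul, LinearMap.add_apply, LinearMap.smul_apply, hhx, hgx, map_zero,
      smul_eq_mul, mul_zero, zero_add, LinearMap.zero_apply] at h3
    exact (mul_eq_zero.mp h3).resolve_left h2
  · push Not at hP
    refine ⟨0, X.NS.zero_mem, map_zero _, fun x hhx _ => X.mem_T_iff.mpr fun D hD => ?_⟩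
    have h1 := hP (X.intersectionForm h h • D - X.intersectionForm h D • h)
      (X.NS.sub_mem (X.NS.smul_mem _ hD) (X.NS.smul_mem _ hh)) (by simp; ring)
    have h2 := congrArg (fun y => X.intersectionForm y x) h1
    simp only [map_sub, map_smul, LinearMap.sub_apply, LinearMap.smul_apply, hhx, map_zero,
      smul_eq_mul, mul_zero, sub_zero, LinearMap.zero_apply] at h2
    exact (mul_eq_zero.mp h2).resolve_left hpos.ne'

/-- Two classes h, g that span NS(X) up to multiples fit into two of the three planes, leaving E₂,
F₂ in T(X). These two planes have signature (2,2), while h and g account for at most one positive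
direction, so their complement there contains a vector m of positive square. -/
theorem exists_isMirrorTriple_of_picardNumber_le_two (hX : X.picardNumber ≤ 2) :
    ∃ e f m, X.IsMirrorTriple e f m := by
  obtain ⟨h, hh, hpos⟩ := X.exists_positive
  obtain ⟨g, hg, hhg, hT⟩ := exists_orthogonal_of_picardNumber_le_two hX hh hpos
  have hodge := X.intersectionForm_neg_or_eq_zero hh hg hpos hhg
  obtain ⟨E₀, F₀, hEF₀⟩ := X.exists_isFrame
  obtain ⟨E₁, F₁, d, k, hEF₁, hh'⟩ := hEF₀.exists_mem_first h
  obtain ⟨E, F, hEF, hE, hF, hg1, hg2, l, hl⟩ := hEF₁.exists_reduced g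
  rw [← hE, ← hF] at hh'
  clear hE hF hEF₁ hEF₀ E₁ F₁ E₀ F₀
  obtain ⟨α, hα⟩ : ∃ α, α = X.intersectionForm g (E 1) := ⟨_, rfl⟩
  obtain ⟨q, hq⟩ : ∃ q, q = X.intersectionForm g (E 0) := ⟨_, rfl⟩
  rw [← hα] at hl
  have hhx : ∀ x, X.intersectionForm h x =
      d * (k * X.intersectionForm x (E 0) + X.intersectionForm x (F 0)) := by
    intro x
    rw [hh', map_smul, map_add, map_smul]
    simp [X.intersectionForm_symm x]
    ring
  have hkd : 0 < 2 * d ^ 2 * k := by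
    have h1 := hpos
    rw [hhx h, X.intersectionForm_symm h, X.intersectionForm_symm h, hh'] at h1
    simp [hEF.ee, hEF.ff, hEF.ef, hEF.fe] at h1
    linarith
  have hd : d ≠ 0 := by rintro rfl; simp at hkd
  have hk : 0 < k := pos_of_mul_pos_right hkd (by positivity)
  have hp : X.intersectionForm g (F 0) = -(k * q) := by
    rw [hhx g, ← hq] at hhg
    have := (mul_eq_zero.mp hhg).resolve_left hd
    linarith
  have hgx : ∀ x, X.intersectionForm g x =
      -(k * q) * X.intersectionForm x (E 0) + q * X.intersectionForm x (F 0) +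
        α * (l * X.intersectionForm x (E 1) + X.intersectionForm x (F 1)) := by
    intro x
    rw [hEF.apply_eq, hg1, hg2, hp, ← hq, hl, ← hα]
    ring
  have hm : ∃ m, X.intersectionForm h m = 0 ∧ X.intersectionForm g m = 0 ∧
      X.intersectionForm m (E 2) = 0 ∧ X.intersectionForm m (F 2) = 0 ∧
      0 < X.intersectionForm m m := by
    by_cases hα0 : α = 0
    · exact ⟨E 1 + F 1, by simp [hhx, hEF.ee, hEF.fe, hEF.ef, hEF.ff],
        by simp [hgx, hα0, hEF.ee, hEF.fe, hEF.ef, hEF.ff], by simp [hEF.ee, hEF.fe],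
        by simp [hEF.ef, hEF.ff], by simp [hEF.ee, hEF.fe, hEF.ef, hEF.ff]⟩
    have hneg : α ^ 2 * l < k * q ^ 2 := by
      rcases hodge with h1 | h1
      · rw [hgx g, hp, ← hq, hl, ← hα] at h1
        linarith
      · rw [h1, map_zero, LinearMap.zero_apply] at hα
        exact absurd hα hα0
    -- The vectors (αs)(F₀ - kE₀) + (2kqs - ly)E₁ + yF₁ are orthogonal to h and g, and this form is
    -- half their square. Its determinant k(α²l - kq²) is negative by `hneg`, so it is indefinite;
    -- the sign of l decides the explicit solution.
    have key : ∃ s y : ℤ, 0 < -(k * α ^ 2 * s ^ 2) + 2 * k * q * s * y - l * y ^ 2 := by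
      rcases lt_trichotomy l 0 with h1 | h1 | h1
      · exact ⟨0, 1, by linarith⟩
      · subst h1
        have hq0 : q ≠ 0 := by rintro rfl; simp at hneg
        have h2 : 0 < q ^ 2 := by positivity
        have h3 : 0 < k * α ^ 2 := by positivity
        refine ⟨1, q * α ^ 2, ?_⟩
        have : 0 < k * α ^ 2 * (2 * q ^ 2 - 1) := mul_pos h3 (by omega)
        linarith
      · refine ⟨l, k * q, ?_⟩
        have : 0 < l * k * (k * q ^ 2 - α ^ 2 * l) := mul_pos (mul_pos h1 hk) (by linarith)
        linarith
    obtain ⟨s, y, hsy⟩ := key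
    refine ⟨(α * s) • (F 0 - k • E 0) + (2 * k * q * s - l * y) • E 1 + y • F 1, ?_, ?_, ?_, ?_,
      ?_⟩
    · rw [hhx]
      simp [hEF.ee, hEF.fe, hEF.ef, hEF.ff]
      right
      ring
    · rw [hgx]
      simp [hEF.ee, hEF.fe, hEF.ef, hEF.ff]
      ring
    · simp [hEF.ee, hEF.fe]
    · simp [hEF.ef, hEF.ff]
    · simp [hEF.ee, hEF.fe, hEF.ef, hEF.ff]
      linarith
  obtain ⟨m, hm1, hm2, hm3, hm4, hm5⟩ := hm
  refine ⟨E 2, F 2, m, ⟨hT _ ?_ ?_, hT _ ?_ ?_, hT _ hm1 hm2, hEF.ee _ _, hEF.ff _ _, ?_, hm3, hm4,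
    hm5⟩⟩ <;> simp [hhx, hgx, hEF.ee, hEF.ff, hEF.ef, hEF.fe]

end AbelianSurface

end MirrorAbelian

end

theorem mainTheorem2 (X : MirrorAbelian.AbelianSurface) :
    (∃ Y : MirrorAbelian.AbelianSurface, X.MirrorPartners Y) ↔
      X.picardNumber ≤ 2 ∨
        (X.picardNumber = 3 ∧ ∃ n : ℕ, 0 < n ∧
          X.formNS.Equivalent
            (MirrorAbelian.orthogonalSum (MirrorAbelian.rankOneForm (-2 * (n : ℤ)))
              MirrorAbelian.hyperbolicPlane)) := by
  constructor
  · rintro ⟨Y, hY, -⟩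
    obtain ⟨e, f, m, h⟩ := MirrorAbelian.AbelianSurface.exists_isMirrorTriple_of_equivalent hY
    obtain ⟨h1, h2⟩ := h.picardNumber_le
    rcases h1.lt_or_eq with h3 | h3
    · exact .inl (Nat.lt_succ_iff.mp h3)
    · exact .inr ⟨h3, h2 h3⟩
  · intro h
    obtain ⟨e, f, m, h⟩ : ∃ e f m, X.IsMirrorTriple e f m := by
      rcases h with h | ⟨-, n, hn, h⟩
      · exact MirrorAbelian.AbelianSurface.exists_isMirrorTriple_of_picardNumber_le_two h
      · exact MirrorAbelian.AbelianSurface.exists_isMirrorTriple_of_picardNumber_eq_three hn h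
    exact h.exists_mirrorPartners
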